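/- **Proposition 1.2.** A Herglotz–Nevanlinna function is an analytic function $m:\mathbb C\setminus\mathbb R\to\mathbb C$ that maps the upper half-plane into the closed upper half-plane and satisfies $m(z)^*=m(z^*)$. Let $m$ be a Herglotz–Nevanlinna function that is rational, and let $D$ be the number of its poles in $\mathbb C$. Then $m$ has an integral representation $$m(z)=a+bz+\int_{\mathbb R}\Bigl(\frac1{\lambda-z}-\frac{\lambda}{1+\lambda^2}\Bigr)d\rho(\lambda),\qquad z\in\mathbb C\setminus\mathbb R,\tag{1}$$ with $a\in\mathbb R$, $b\ge 0$ and a non-negative Borel measure $\rho$ on $\mathbb R$ such that $\int_{\mathbb R}(1+\lambda^2)^{-1}d\rho(\lambda)<\infty$. For any $a,b,\rho$ as in (1), all moments of $\rho$ exist. Put $$s_{-2}=-b,\qquad s_{-1}=\int_{\mathbb R}\frac{\lambda}{1+\lambda^2}\,d\rho(\lambda)-a,\qquad s_k=\int_{\mathbb R}\lambda^k\,d\rho(\lambda)\quad(k\ge 0),$$ and for $j\in\{-2,-1,0,1\}$ and $k\ge 0$ let $\Delta_{j,k}=\det(s_{j+p+q})_{p,q=0}^{k-1}$, with $\Delta_{j,0}=1$.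 Let $N\ge0$ be such that precisely $N+1$ of the numbers $\Delta_{1,0},\ldots,\Delta_{1,D}$ are non-zero, and for $n\in\{1,\ldots,N+1\}$ let $\kappa(n)$ be the smallest $k\ge 0$ for which precisely $n$ of the numbers $\Delta_{1,0},\ldots,\Delta_{1,k}$ are non-zero. Then $m$ admits the continued fraction expansion $$m(z)=\upsilon_0z+\omega_0+\cfrac{1}{-l_1z+\cfrac{1}{\upsilon_1z+\omega_1+\cfrac{1}{\;\ddots\;+\cfrac{1}{-l_Nz+\cfrac{1}{\upsilon_Nz+\omega_N-\cfrac rz}}}}}\,,\qquad z\in\mathbb C\setminus\mathbb R,$$ in which no denominator vanishes (and which reads $m(z)=\upsilon_0z+\omega_0-r/z$ when $N=0$). Here the non-negative constants $\upsilon_0,\ldots,\upsilon_N$ and the real constants $\omega_0,\ldots,\omega_N$ are given by $$\upsilon_0=-\frac{\Delta_{-2,1}}{\Delta_{0,0}},\qquad \upsilon_n=\frac{\Delta_{-2,\kappa(n)+2}}{\Delta_{0,\kappa(n)+1}}-\frac{\Delta_{-2,\kappa(n+1)+1}}{\Delta_{0,\kappa(n+1)}},$$ $$\omega_0=-\frac{\Delta_{-1,1}}{\Delta_{1,0}},\qquad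 \omega_n=\frac{\Delta_{-1,\kappa(n)+1}}{\Delta_{1,\kappa(n)}}-\frac{\Delta_{-1,\kappa(n+1)+1}}{\Delta_{1,\kappa(n+1)}}$$ for $n\in\{1,\ldots,N\}$, and the positive constants $l_1,\ldots,l_N$ and the non-negative constant $r$ are given by $$l_n=\frac{\Delta_{1,\kappa(n)}^2}{\Delta_{0,\kappa(n)}\Delta_{0,\kappa(n)+1}},\qquad r=\frac{\Delta_{0,\kappa(N+1)}\Delta_{0,\kappa(N+1)+1}}{\Delta_{1,\kappa(N+1)}^2},$$ all denominators in these formulas being non-zero. -/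

import Mathlib

open MeasureTheory
open scoped ComplexConjugate

/-- A Herglotz–Nevanlinna function: analytic on `ℂ \ ℝ`, mapping the upper half-plane into the
closed upper half-plane, and symmetric with respect to complex conjugation. The values of `m` on
the real line are irrelevant. -/
structure IsHerglotzNevanlinna (m : ℂ → ℂ) : Prop where
  analytic : AnalyticOnNhd ℂ m {z : ℂ | z.im ≠ 0}
  im_nonneg : ∀ z : ℂ, 0 < z.im → 0 ≤ (m z).im
  symm : ∀ z : ℂ, z.im ≠ 0 → conj (m z) = m (conj z)

/-- The integral representation `m(z) = a + b z + ∫ (1/(λ - z) - λ/(1 + λ²)) dρ(λ)` on `ℂ \ ℝ`, with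
`b ≥ 0` and a Borel measure `ρ` on `ℝ` such that `∫ dρ(λ)/(1 + λ²) < ∞`. -/
structure IsHerglotzRepresentation (m : ℂ → ℂ) (a b : ℝ) (ρ : Measure ℝ) : Prop where
  b_nonneg : 0 ≤ b
  growth : Integrable (fun x : ℝ => 1 / (1 + x ^ 2)) ρ
  eq : ∀ z : ℂ, z.im ≠ 0 →
    m z = a + b * z + ∫ x : ℝ, (1 / ((x : ℂ) - z) - (x : ℂ) / (1 + (x : ℂ) ^ 2)) ∂ρ

/-- The extended moment sequence `s_{-2}, s_{-1}, s_0, s_1, …` (zero below index `-2`, where it is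
never used): `s_k = ∫ λ^k dρ(λ)` for `k ≥ 0`, `s_{-1} = ∫ λ/(1 + λ²) dρ(λ) - a`, `s_{-2} = -b`. -/
noncomputable def extMoment (a b : ℝ) (ρ : Measure ℝ) : ℤ → ℝ
  | Int.ofNat k => ∫ x : ℝ, x ^ k ∂ρ
  | Int.negSucc 0 => (∫ x : ℝ, x / (1 + x ^ 2) ∂ρ) - a
  | Int.negSucc 1 => -b
  | Int.negSucc (_ + 2) => 0

/-- The Hankel determinant `Δ_{j,k}`: the `k × k` determinant with entries `s_{j + p + q}`,
`0 ≤ p, q < k`. It equals one for `k = 0`. -/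
noncomputable def hankelDet (s : ℤ → ℝ) (j : ℤ) (k : ℕ) : ℝ :=
  (Matrix.of fun p q : Fin k => s (j + (p : ℕ) + (q : ℕ))).det

open Classical in
/-- The number of non-zero elements among `Δ_{1,0}, …, Δ_{1,k}`. -/
noncomputable def nonzeroCount (s : ℤ → ℝ) (k : ℕ) : ℕ :=
  Nat.count (fun j => hankelDet s 1 j ≠ 0) (k + 1)

/-- `κ(n)` is the smallest `k` such that precisely `n` of `Δ_{1,0}, …, Δ_{1,k}` are non-zero. -/
noncomputable def kappa (s : ℤ → ℝ) (n : ℕ) : ℕ :=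
  sInf {k : ℕ | nonzeroCount s k = n}

/-- The number `N` such that precisely `N + 1` of `Δ_{1,0}, …, Δ_{1,D}` are non-zero. -/
noncomputable def cfLength (s : ℤ → ℝ) (D : ℕ) : ℕ :=
  nonzeroCount s D - 1

theorem nonzeroCount_pos (s : ℤ → ℝ) (D : ℕ) : 0 < nonzeroCount s D := by
  classical
  unfold nonzeroCount
  rw [Nat.count_succ']
  simp [hankelDet]

/-- The subtraction in `cfLength` does not truncate. -/
theorem cfLength_add_one (s : ℤ → ℝ) (D : ℕ) : nonzeroCount s D = cfLength s D + 1 := by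
  have := nonzeroCount_pos s D
  unfold cfLength
  omega

/-- The minimum defining `κ(n)` is attained for `1 ≤ n ≤ N + 1`, and `κ(n) ≤ D`. -/
theorem kappa_spec (s : ℤ → ℝ) (D n : ℕ) (h1 : 1 ≤ n) (hn : n ≤ cfLength s D + 1) :
    nonzeroCount s (kappa s n) = n ∧ kappa s n ≤ D := by
  rw [← cfLength_add_one] at hn
  have key : ∃ k ≤ D, nonzeroCount s k = n := by
    induction D with
    | zero =>
      refine ⟨0, le_rfl, le_antisymm ?_ hn⟩
      refine le_trans ?_ h1
      classical
      unfold nonzeroCount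
      exact Nat.count_le _
    | succ d ih =>
      by_cases h : n ≤ nonzeroCount s d
      · obtain ⟨k, hk, e⟩ := ih h
        exact ⟨k, hk.trans (Nat.le_succ d), e⟩
      · refine ⟨d + 1, le_rfl, le_antisymm ?_ hn⟩
        have : nonzeroCount s (d + 1) ≤ nonzeroCount s d + 1 := by
          classical
          unfold nonzeroCount
          rw [Nat.count_succ _ (d + 1)]
          split_ifs <;> omega
        omega
  obtain ⟨k, hk, e⟩ := key
  exact ⟨Nat.sInf_mem (s := {k : ℕ | nonzeroCount s k = n}) ⟨k, e⟩,
    (Nat.sInf_le (show k ∈ {k : ℕ | nonzeroCount s k = n} from e)).trans hk⟩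

/-- The tail of the continued fraction with `j` remaining levels, beginning at level `n`:
`q = -r/z` if no level remains, and otherwise
`q = 1 / (-l_n z + 1 / (υ_n z + ω_n + q'))`, where `q'` is the tail with `j - 1` remaining levels
beginning at level `n + 1`. -/
noncomputable def cfTail (υ ω l : ℕ → ℝ) (r : ℝ) (z : ℂ) : (j n : ℕ) → ℂ
  | 0, _ => -(r / z)
  | j + 1, n => 1 / (-(l n * z) + 1 / (υ n * z + ω n + cfTail υ ω l r z j (n + 1)))

/-- The value at `z` of the continued fraction with `N` levels. -/
noncomputable def cfValue (υ ω l : ℕ → ℝ) (r : ℝ) (N : ℕ) (z : ℂ) : ℂ :=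
  υ 0 * z + ω 0 + cfTail υ ω l r z N 1

/-- No denominator occurring in the continued fraction with `N` levels vanishes at `z`
(apart from that of `r/z`, which is `z`). -/
def CFWellDefined (υ ω l : ℕ → ℝ) (r : ℝ) (N : ℕ) (z : ℂ) : Prop :=
  ∀ n : ℕ, 1 ≤ n → n ≤ N →
    υ n * z + ω n + cfTail υ ω l r z (N - n) (n + 1) ≠ 0 ∧
    -(l n * z) + 1 / (υ n * z + ω n + cfTail υ ω l r z (N - n) (n + 1)) ≠ 0

/-- The number of (distinct) poles in `ℂ` of a rational function. -/
noncomputable def numPoles (R : RatFunc ℂ) : ℕ :=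
  R.denom.roots.toFinset.card

/-!
By partial fractions, a rational Herglotz–Nevanlinna function is
`m(z) = A + b z + ∑ x ∈ S, c x / (x - z)` with `A` real, `b ≥ 0`, a finite set `S ⊆ ℝ` and
`c x > 0`: continuity excludes non-real poles, and since `Im m ≥ 0` on the upper half-plane,
comparison with the leading monomial at a pole or at infinity forces simple poles with negative
residues and at most linear growth (`eq_one_of_im_mul_pow_nonneg`). This gives an integral representation with a finite
sum of point masses. Conversely, the measure `ρ` of any integral representation lives on `S`: away
from `S` one has `Im m(x + i y) = O(y)`, whence `ρ [x - y, x + y] = O(y²)`, and subdividing an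
interval shows that it is a null set (`IsHerglotzRepresentation.measure_compl`).

For the expansion, let `L f = ∫ f dρ` on polynomials and `d = #supp ρ`. Cramer's rule expresses the
Hankel determinants through two families of polynomials: the polynomials `p_k` of degree at most `k`
with `p_k(0) = 1` that are orthogonal to all lower degrees, which exist when `Δ_{1,k} ≠ 0`, and the
polynomials `K_k` of degree less than `k` with `L (f K_k) = f(0)` for `deg f < k`, where `k ≤ d`.
One finds `L (p_k²) = Δ_{0,k} Δ_{0,k+1} / Δ_{1,k}²`, the kernel `K_{k+1}` equals
`K_k + p_k / L (p_k²)` or `K_k` according to whether `Δ_{1,k}` is non-zero or not, and for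
consecutive `k = κ(n)`, `k' = κ(n + 1)`, which differ by one or two,
`p_k - p_{k'} = (ω_n + υ_n X) X K_{k+1}` (`IsFiniteMomentSequence.sub_eq`).

Under the Cauchy transform `f ↦ ∫ f(λ) / (λ - z) dρ(λ)` these polynomial identities become the
recursion `U_{n+1} = U_n + l_n z T_n`, `T_n - T_{n+1} = (ω_n + υ_n z) U_{n+1}` for the transforms
`T_n` of `p_{κ(n)}` and `U_n = 1 + z · (transform of K_{κ(n)})`. It ends with
`T_{N+1} = -(r / z) U_{N+1}`, because `p_d` or `X K_d` vanishes on the support. Hence `T_n / U_n` is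
the `n`-th tail of the continued fraction (`cfTail_of_recursion`). No denominator vanishes since a
tail maps each half-plane into itself unless it vanishes identically.
-/

/-! ### Moment functionals and Hankel determinants -/

theorem eq_sum_monomial_of_mem_degreeLT {k : ℕ} {f : Polynomial ℝ}
    (hf : f ∈ Polynomial.degreeLT ℝ k) :
    f = ∑ i ∈ Finset.range k, Polynomial.monomial i (f.coeff i) := by
  ext m
  simp only [Polynomial.finsetSum_coeff, Polynomial.coeff_monomial, Finset.sum_ite_eq',
    Finset.mem_range]
  split_ifs with h
  · rfl
  · exact (Polynomial.degree_lt_iff_coeff_zero f k).1 (Polynomial.mem_degreeLT.1 hf) m (not_lt.1 h)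

open Polynomial in
/-- The linear functional `f ↦ ∑ i, f_i s_{j + i}` on real polynomials. For a moment sequence `s` of
a measure `ρ` and `j ≥ 0` it is `f ↦ ∫ λ^j f(λ) dρ(λ)`; negative `j` give access to the extended
moments `s_{-1}` and `s_{-2}`. -/
noncomputable def momentFunctional (s : ℤ → ℝ) (j : ℤ) : ℝ[X] →ₗ[ℝ] ℝ :=
  Polynomial.lsum fun i => s (j + i) • LinearMap.id

namespace momentFunctional

open Polynomial

variable {s : ℤ → ℝ} {j : ℤ} {k : ℕ} {f g : ℝ[X]}

theorem monomial (i : ℕ) (a : ℝ) :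
    momentFunctional s j (Polynomial.monomial i a) = a * s (j + i) := by
  simp [momentFunctional, Polynomial.lsum_apply, Polynomial.sum_monomial_index, mul_comm]

theorem C (a : ℝ) : momentFunctional s j (Polynomial.C a) = a * s j := by
  simpa using monomial (s := s) (j := j) 0 a

theorem one : momentFunctional s j 1 = s j := by simpa using C (s := s) (j := j) 1

theorem X_mul (f : ℝ[X]) : momentFunctional s j (X * f) = momentFunctional s (j + 1) f := by
  induction f using Polynomial.induction_on' with
  | add p q hp hq => rw [mul_add, map_add, map_add, hp, hq]
  | monomial n a =>
    rw [X_mul_monomial, monomial, monomial]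
    congr 2
    push_cast
    ring

theorem X_pow_mul (i : ℕ) (f : ℝ[X]) :
    momentFunctional s j (X ^ i * f) = momentFunctional s (j + i) f := by
  induction i generalizing j with
  | zero => simp
  | succ i ih =>
    rw [pow_succ', mul_assoc, X_mul, ih]
    congr 2
    push_cast
    ring

theorem eq_sum_range (hf : f ∈ degreeLT ℝ k) :
    momentFunctional s j f = ∑ i ∈ Finset.range k, f.coeff i * s (j + i) := by
  conv_lhs => rw [eq_sum_monomial_of_mem_degreeLT hf]
  rw [map_sum]
  exact Finset.sum_congr rfl fun i _ => monomial i _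

theorem mul_eq_sum_range (hg : g ∈ degreeLT ℝ k) (f : ℝ[X]) :
    momentFunctional s j (g * f) =
      ∑ i ∈ Finset.range k, g.coeff i * momentFunctional s j (X ^ i * f) := by
  conv_lhs => rw [eq_sum_monomial_of_mem_degreeLT hg]
  rw [Finset.sum_mul, map_sum]
  refine Finset.sum_congr rfl fun i _ => ?_
  rw [← C_mul_X_pow_eq_monomial, mul_assoc, ← smul_eq_C_mul, map_smul, smul_eq_mul]

theorem mul_eq_zero (hg : g ∈ degreeLT ℝ k)
    (hf : ∀ i < k, momentFunctional s j (X ^ i * f) = 0) : momentFunctional s j (g * f) = 0 := by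
  rw [mul_eq_sum_range hg]
  exact Finset.sum_eq_zero fun i hi => by rw [hf i (Finset.mem_range.1 hi), mul_zero]

/-- If only the top moment of `f` is non-zero, pairing with `f` reads off the top coefficient. -/
theorem mul_eq_coeff_mul (hg : g ∈ degreeLT ℝ (k + 1))
    (hf : ∀ i < k, momentFunctional s j (X ^ i * f) = 0) :
    momentFunctional s j (g * f) = g.coeff k * momentFunctional s j (X ^ k * f) := by
  rw [mul_eq_sum_range hg, Finset.sum_range_succ, Finset.sum_eq_zero, zero_add]
  exact fun i hi => by rw [hf i (Finset.mem_range.1 hi), mul_zero]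

end momentFunctional

section Hankel

open Polynomial

variable {s : ℤ → ℝ} {j : ℤ} {k : ℕ} {f g : ℝ[X]}

theorem mem_degreeLT_of_coeff_eq_zero (hf : f ∈ degreeLT ℝ (k + 1)) (h : f.coeff k = 0) :
    f ∈ degreeLT ℝ k := by
  rw [mem_degreeLT, degree_lt_iff_coeff_zero] at *
  intro m hm
  rcases hm.eq_or_lt with rfl | hm
  · exact h
  · exact hf m hm

theorem X_mul_mem_degreeLT (hf : f ∈ degreeLT ℝ k) : X * f ∈ degreeLT ℝ (k + 1) := by
  rw [mem_degreeLT, degree_lt_iff_coeff_zero] at *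
  intro m hm
  obtain ⟨m, rfl⟩ : ∃ m', m = m' + 1 := ⟨m - 1, by omega⟩
  rw [coeff_X_mul]
  exact hf m (by omega)

theorem mem_degreeLT_of_X_mul (hf : X * f ∈ degreeLT ℝ (k + 1)) : f ∈ degreeLT ℝ k := by
  rw [mem_degreeLT, degree_lt_iff_coeff_zero] at *
  intro m hm
  rw [← coeff_X_mul]
  exact hf (m + 1) (by omega)

theorem one_mem_degreeLT : (1 : ℝ[X]) ∈ degreeLT ℝ (k + 1) := by
  rw [mem_degreeLT, degree_one]
  exact_mod_cast Nat.succ_pos k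

/-- The Hankel matrix whose determinant is `hankelDet s j k`. -/
noncomputable def hankelMatrix (s : ℤ → ℝ) (j : ℤ) (k : ℕ) : Matrix (Fin k) (Fin k) ℝ :=
  Matrix.of fun p q : Fin k => s (j + (p : ℕ) + (q : ℕ))

/-- The Hankel matrix maps the coefficients of a polynomial to its moments. -/
theorem hankelMatrix_mulVec_coeff (hf : f ∈ degreeLT ℝ k) :
    (hankelMatrix s j k).mulVec (fun i : Fin k => f.coeff i) =
      fun i : Fin k => momentFunctional s j (X ^ (i : ℕ) * f) := by
  funext i
  rw [momentFunctional.X_pow_mul, momentFunctional.eq_sum_range hf, Matrix.mulVec, dotProduct,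
    ← Fin.sum_univ_eq_sum_range (fun q => f.coeff q * s (j + (i : ℕ) + q))]
  simp [hankelMatrix, mul_comm]

theorem exists_mem_degreeLT_coeff (v : Fin k → ℝ) :
    ∃ f ∈ degreeLT ℝ k, (fun i : Fin k => f.coeff i) = v := by
  obtain ⟨f, hf⟩ := (degreeLTEquiv ℝ k).surjective v
  exact ⟨f, f.2, hf⟩

/-- A non-zero Hankel determinant allows to prescribe the moments of a polynomial. -/
theorem exists_moments_eq (h : hankelDet s j k ≠ 0) (w : ℕ → ℝ) :
    ∃ f ∈ degreeLT ℝ k, ∀ i < k, momentFunctional s j (X ^ i * f) = w i := by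
  have hu : IsUnit (hankelMatrix s j k).det := isUnit_iff_ne_zero.2 h
  obtain ⟨f, hf, hv⟩ := exists_mem_degreeLT_coeff
    ((hankelMatrix s j k)⁻¹.mulVec fun i : Fin k => w i)
  refine ⟨f, hf, fun i hi => ?_⟩
  have := congrFun (hankelMatrix_mulVec_coeff (s := s) (j := j) hf) ⟨i, hi⟩
  rw [hv, Matrix.mulVec_mulVec, Matrix.mul_nonsing_inv _ hu, Matrix.one_mulVec] at this
  exact this.symm

theorem hankelDet_eq_zero_iff : hankelDet s j k = 0 ↔
    ∃ f ∈ degreeLT ℝ k, f ≠ 0 ∧ ∀ i < k, momentFunctional s j (X ^ i * f) = 0 := by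
  change (hankelMatrix s j k).det = 0 ↔ _
  rw [← Matrix.exists_mulVec_eq_zero_iff]
  constructor
  · rintro ⟨v, hv, h⟩
    obtain ⟨f, hf, rfl⟩ := exists_mem_degreeLT_coeff v
    rw [hankelMatrix_mulVec_coeff hf] at h
    refine ⟨f, hf, ?_, fun i hi => congrFun h ⟨i, hi⟩⟩
    rintro rfl
    exact hv (by funext i; simp)
  · rintro ⟨f, hf, h0, h⟩
    refine ⟨fun i : Fin k => f.coeff i, fun hv => h0 ?_, ?_⟩
    · ext m
      by_cases hm : m < k
      · exact congrFun hv ⟨m, hm⟩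
      · exact degree_lt_iff_coeff_zero f k |>.1 (mem_degreeLT.1 hf) m (not_lt.1 hm)
    · rw [hankelMatrix_mulVec_coeff hf]
      funext i
      exact h i i.2

/-- Cramer's rule for a polynomial with a single non-zero moment. -/
theorem hankelMatrix_adjugate_mul (hf : f ∈ degreeLT ℝ k) (b : Fin k) (e : ℝ)
    (h : ∀ i : Fin k, momentFunctional s j (X ^ (i : ℕ) * f) = if i = b then e else 0)
    (a : Fin k) :
    (hankelMatrix s j k).adjugate a b * e = hankelDet s j k * f.coeff a := by
  have h1 : (hankelMatrix s j k).mulVec (fun i : Fin k => f.coeff i) = Pi.single b e := by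
    rw [hankelMatrix_mulVec_coeff hf]
    funext i
    rw [h i, Pi.single_apply]
  have h2 := congrArg (hankelMatrix s j k).adjugate.mulVec h1
  rw [Matrix.mulVec_mulVec, Matrix.adjugate_mul, Matrix.smul_mulVec, Matrix.one_mulVec] at h2
  have h3 := congrFun h2 a
  rw [Matrix.mulVec_single] at h3
  simp only [Pi.smul_apply, smul_eq_mul] at h3
  rw [show hankelDet s j k = (hankelMatrix s j k).det from rfl, h3]
  simp

/-- Expansion at the upper left corner: the quotient of `Δ_{j,k+1}` and `Δ_{j+2,k}` is the lowest
moment of the polynomial with constant term `1` whose other moments vanish. -/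
theorem hankelDet_succ_eq (hf : f ∈ degreeLT ℝ (k + 1)) (h0 : f.coeff 0 = 1)
    (h : ∀ i < k, momentFunctional s j (X ^ (i + 1) * f) = 0) :
    hankelDet s j (k + 1) = momentFunctional s j f * hankelDet s (j + 2) k := by
  have := hankelMatrix_adjugate_mul (s := s) (j := j) hf 0 (momentFunctional s j f) ?_ 0
  · rw [Fin.val_zero, h0, mul_one] at this
    rw [← this, Matrix.adjugate_fin_succ_eq_det_submatrix, mul_comm]
    simp only [Fin.val_zero, add_zero, pow_zero, one_mul]
    congr 1
    unfold hankelDet hankelMatrix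
    congr 1
    ext p q
    simp only [Matrix.submatrix_apply, Matrix.of_apply, Fin.zero_succAbove, Fin.val_succ]
    congr 1
    push_cast
    ring
  · intro i
    refine Fin.cases ?_ (fun i => ?_) i
    · simp
    · simpa using h i i.2

/-- Cramer's rule for the constant and the leading coefficient of an orthogonal polynomial. -/
theorem hankelDet_coeff_of_orthogonal (hf : f ∈ degreeLT ℝ (k + 1))
    (h : ∀ i < k, momentFunctional s 0 (X ^ i * f) = 0) :
    hankelDet s 0 (k + 1) * f.coeff 0 =
      (-1) ^ k * hankelDet s 1 k * momentFunctional s 0 (X ^ k * f) ∧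
    hankelDet s 0 (k + 1) * f.coeff k =
      hankelDet s 0 k * momentFunctional s 0 (X ^ k * f) := by
  have := hankelMatrix_adjugate_mul (s := s) (j := 0) hf (Fin.last k)
    (momentFunctional s 0 (X ^ k * f)) ?_
  · constructor
    · rw [← Fin.val_zero (k + 1), ← this 0, Matrix.adjugate_fin_succ_eq_det_submatrix]
      simp only [Fin.val_zero, add_zero, Fin.val_last]
      congr 2
      unfold hankelDet hankelMatrix
      congr 1
      ext p q
      simp only [Matrix.submatrix_apply, Matrix.of_apply, Fin.zero_succAbove, Fin.val_succ,
        Fin.succAbove_last, Fin.val_castSucc]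
      congr 1
      push_cast
      ring
    · have h2 := this (Fin.last k)
      rw [Fin.val_last] at h2
      rw [← h2, Matrix.adjugate_fin_succ_eq_det_submatrix]
      simp only [Fin.val_last, Fin.succAbove_last]
      rw [Even.neg_one_pow ⟨k, rfl⟩, one_mul]
      congr 1
  · intro i
    refine Fin.lastCases ?_ (fun i => ?_) i
    · simp
    · rw [if_neg (Fin.castSucc_lt_last i).ne]
      simpa using h i i.2

end Hankel

/-! ### Orthogonal and reproducing polynomials of a finite moment sequence -/

section FiniteMoments

open Polynomial

/-- The non-negatively indexed part of `s` is the moment sequence of the measure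
`∑ x ∈ S, c x • δ_x` with positive weights `c x`. -/
structure IsFiniteMomentSequence (s : ℤ → ℝ) (S : Finset ℝ) (c : ℝ → ℝ) : Prop where
  pos : ∀ x ∈ S, 0 < c x
  moment : ∀ k : ℕ, s k = ∑ x ∈ S, c x * x ^ k

/-- `p` is the polynomial of degree at most `k` with `p(0) = 1` that is orthogonal to all
polynomials of degree less than `k`. -/
structure IsOrthogonalPoly (s : ℤ → ℝ) (k : ℕ) (p : ℝ[X]) : Prop where
  mem : p ∈ degreeLT ℝ (k + 1)
  coeff_zero : p.coeff 0 = 1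
  moment : ∀ i < k, momentFunctional s 0 (X ^ i * p) = 0

/-- `K` is the polynomial of degree less than `k` that represents evaluation at `0` on all
polynomials of degree less than `k`. -/
structure IsReproducingPoly (s : ℤ → ℝ) (k : ℕ) (K : ℝ[X]) : Prop where
  mem : K ∈ degreeLT ℝ k
  moment : ∀ i < k, momentFunctional s 0 (X ^ i * K) = if i = 0 then 1 else 0

variable {s : ℤ → ℝ} {S : Finset ℝ} {c : ℝ → ℝ} {k : ℕ} {f g p K : ℝ[X]}

namespace IsFiniteMomentSequence

theorem apply (h : IsFiniteMomentSequence s S c) (f : ℝ[X]) :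
    momentFunctional s 0 f = ∑ x ∈ S, c x * f.eval x := by
  induction f using Polynomial.induction_on' with
  | add p q hp hq => simp only [map_add, hp, hq, eval_add, mul_add, Finset.sum_add_distrib]
  | monomial n a =>
    rw [momentFunctional.monomial, zero_add, h.moment, Finset.mul_sum]
    refine Finset.sum_congr rfl fun x _ => ?_
    rw [eval_monomial]
    ring

theorem mul_self_nonneg (h : IsFiniteMomentSequence s S c) (f : ℝ[X]) :
    0 ≤ momentFunctional s 0 (f * f) := by
  rw [h.apply]
  refine Finset.sum_nonneg fun x hx => mul_nonneg (h.pos x hx).le ?_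
  rw [eval_mul]
  exact _root_.mul_self_nonneg _

theorem eval_eq_zero_of_mul_self (h : IsFiniteMomentSequence s S c)
    (hf : momentFunctional s 0 (f * f) = 0) {x : ℝ} (hx : x ∈ S) : f.eval x = 0 := by
  rw [h.apply, Finset.sum_eq_zero_iff_of_nonneg] at hf
  · have := hf x hx
    rw [eval_mul] at this
    simpa [(h.pos x hx).ne'] using this
  · intro y hy
    rw [eval_mul]
    exact mul_nonneg (h.pos y hy).le (_root_.mul_self_nonneg _)

theorem eq_zero_of_mul_self (h : IsFiniteMomentSequence s S c) (hk : k ≤ S.card)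
    (hf : f ∈ degreeLT ℝ k) (h0 : momentFunctional s 0 (f * f) = 0) : f = 0 := by
  refine eq_zero_of_degree_lt_of_eval_finset_eq_zero S
    ((mem_degreeLT.1 hf).trans_le (by exact_mod_cast hk)) fun x hx =>
      h.eval_eq_zero_of_mul_self h0 hx

theorem eq_zero_of_moments (h : IsFiniteMomentSequence s S c) (hk : k ≤ S.card)
    (hf : f ∈ degreeLT ℝ k) (h0 : ∀ i < k, momentFunctional s 0 (X ^ i * f) = 0) : f = 0 :=
  h.eq_zero_of_mul_self hk hf (momentFunctional.mul_eq_zero hf h0)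

theorem eq_of_moments (h : IsFiniteMomentSequence s S c) (hk : k ≤ S.card)
    (hf : f ∈ degreeLT ℝ k) (hg : g ∈ degreeLT ℝ k)
    (h0 : ∀ i < k, momentFunctional s 0 (X ^ i * f) = momentFunctional s 0 (X ^ i * g)) :
    f = g := by
  refine sub_eq_zero.1 (h.eq_zero_of_moments hk (Submodule.sub_mem _ hf hg) fun i hi => ?_)
  rw [mul_sub, map_sub, h0 i hi, sub_self]

/-- A polynomial of any degree that is orthogonal to all polynomials of degree less than `#S`
vanishes on `S`. -/
theorem eval_eq_zero_of_moments (h : IsFiniteMomentSequence s S c)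
    (h0 : ∀ i < S.card, momentFunctional s 0 (X ^ i * f) = 0) {x : ℝ} (hx : x ∈ S) :
    f.eval x = 0 := by
  have hinj : Set.InjOn (id : ℝ → ℝ) S := Function.injective_id.injOn
  have hg : Lagrange.interpolate S id (fun y => f.eval y) ∈ degreeLT ℝ S.card :=
    mem_degreeLT.2 (Lagrange.degree_interpolate_lt _ hinj)
  have h1 := momentFunctional.mul_eq_zero hg h0
  refine h.eval_eq_zero_of_mul_self (f := f) ?_ hx
  rw [h.apply] at h1 ⊢
  rw [← h1]
  refine Finset.sum_congr rfl fun y hy => ?_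
  have := Lagrange.eval_interpolate_at_node (fun y => f.eval y) hinj hy
  rw [id] at this
  rw [eval_mul, eval_mul, this]

theorem hankelDet_zero_ne_zero (h : IsFiniteMomentSequence s S c) (hk : k ≤ S.card) :
    hankelDet s 0 k ≠ 0 := by
  intro h0
  obtain ⟨f, hf, hne, hm⟩ := hankelDet_eq_zero_iff.1 h0
  exact hne (h.eq_zero_of_moments hk hf hm)

/-- The nodal polynomial of `S` lies in the kernel of every larger Hankel matrix. -/
theorem hankelDet_one_eq_zero (h : IsFiniteMomentSequence s S c) (hk : S.card < k) :
    hankelDet s 1 k = 0 := by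
  refine hankelDet_eq_zero_iff.2 ⟨Lagrange.nodal S id, ?_, Lagrange.nodal_ne_zero, fun i _ => ?_⟩
  · rw [mem_degreeLT, Lagrange.degree_nodal]
    exact_mod_cast hk
  · have : momentFunctional s 1 (X ^ i * Lagrange.nodal S id) =
        momentFunctional s 0 (X * (X ^ i * Lagrange.nodal S id)) := by
      rw [momentFunctional.X_mul, zero_add]
    rw [this, h.apply]
    refine Finset.sum_eq_zero fun x hx => ?_
    have := Lagrange.eval_nodal_at_node (v := (id : ℝ → ℝ)) hx
    rw [id] at this
    simp [this]

end IsFiniteMomentSequence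

theorem momentFunctional_one_X_pow_mul (i : ℕ) (f : ℝ[X]) :
    momentFunctional s 1 (X ^ i * f) = momentFunctional s 0 (X ^ i * (X * f)) := by
  rw [mul_left_comm, momentFunctional.X_mul, zero_add]

/-- If `Δ_{1,k}` vanishes, then up to a constant factor the orthogonal polynomial of degree `k` is
`X * w`. -/
theorem IsFiniteMomentSequence.exists_of_hankelDet_one_eq_zero (h : IsFiniteMomentSequence s S c)
    (hk : k ≤ S.card) (h0 : hankelDet s 1 k = 0) :
    ∃ w ∈ degreeLT ℝ k, X * w ∉ degreeLT ℝ k ∧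
      ∀ i < k, momentFunctional s 0 (X ^ i * (X * w)) = 0 := by
  obtain ⟨w, hw, hne, hm⟩ := hankelDet_eq_zero_iff.1 h0
  simp only [momentFunctional_one_X_pow_mul] at hm
  exact ⟨w, hw, fun hX => mul_ne_zero X_ne_zero hne (h.eq_zero_of_moments hk hX hm), hm⟩

/-- Up to the index `#S`, no two consecutive `Δ_{1,k}` vanish: otherwise there would be two
consecutive orthogonal polynomials divisible by `X`. -/
theorem IsFiniteMomentSequence.hankelDet_one_ne_zero_or (h : IsFiniteMomentSequence s S c)
    (hk : k + 1 ≤ S.card) : hankelDet s 1 k ≠ 0 ∨ hankelDet s 1 (k + 1) ≠ 0 := by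
  by_contra! h0
  obtain ⟨v, hv, hXv, hvm⟩ := h.exists_of_hankelDet_one_eq_zero (by omega) h0.1
  obtain ⟨w, hw, hXw, hwm⟩ := h.exists_of_hankelDet_one_eq_zero hk h0.2
  have hwk : w.coeff k ≠ 0 := fun hc =>
    hXw (X_mul_mem_degreeLT (mem_degreeLT_of_coeff_eq_zero hw hc))
  have h1 : momentFunctional s 0 (v * (X * w)) = 0 :=
    momentFunctional.mul_eq_zero (degreeLT_mono (Nat.le_succ k) hv) hwm
  rw [show v * (X * w) = w * (X * v) by ring, momentFunctional.mul_eq_coeff_mul hw hvm] at h1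
  have h2 := h.eq_zero_of_moments hk (X_mul_mem_degreeLT hv) fun i hi => by
    rcases (Nat.lt_succ_iff.1 hi).lt_or_eq with hi | rfl
    · exact hvm i hi
    · exact (mul_eq_zero.1 h1).resolve_left hwk
  exact hXv (h2 ▸ Submodule.zero_mem _)

namespace IsReproducingPoly

theorem mul_eq (hK : IsReproducingPoly s k K) (hg : g ∈ degreeLT ℝ k) :
    momentFunctional s 0 (g * K) = g.coeff 0 := by
  rw [momentFunctional.mul_eq_sum_range hg]
  have : ∀ i ∈ Finset.range k, g.coeff i * momentFunctional s 0 (X ^ i * K) =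
      if i = 0 then g.coeff i else 0 := fun i hi => by
    rw [hK.moment i (Finset.mem_range.1 hi), mul_ite, mul_one, mul_zero]
  rw [Finset.sum_congr rfl this, Finset.sum_ite_eq']
  split_ifs with h0
  · rfl
  · obtain rfl : k = 0 := by simpa using h0
    exact ((degree_lt_iff_coeff_zero g 0).1 (mem_degreeLT.1 hg) 0 le_rfl).symm

theorem exists_of_le (h : IsFiniteMomentSequence s S c) (hk : k ≤ S.card) :
    ∃ K, IsReproducingPoly s k K :=
  let ⟨K, hK, hm⟩ := exists_moments_eq (h.hankelDet_zero_ne_zero hk) fun i => if i = 0 then 1 else 0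
  ⟨K, hK, hm⟩

theorem eq_zero (hK : IsReproducingPoly s 0 K) : K = 0 := by
  simpa [mem_degreeLT, Nat.WithBot.lt_zero_iff] using hK.mem

/-- If `Δ_{1,k}` vanishes, then the reproducing property extends to degree `k`. -/
theorem moment_eq_zero (hK : IsReproducingPoly s k K) (h : IsFiniteMomentSequence s S c)
    (hk : k ≤ S.card) (h0 : hankelDet s 1 k = 0) :
    momentFunctional s 0 (X ^ k * K) = 0 := by
  obtain ⟨w, hw, hXw, hm⟩ := h.exists_of_hankelDet_one_eq_zero hk h0
  have h1 := momentFunctional.mul_eq_zero hK.mem hm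
  rw [show K * (X * w) = (X * w) * K by ring,
    momentFunctional.mul_eq_sum_range (X_mul_mem_degreeLT hw), Finset.sum_range_succ,
    Finset.sum_eq_zero, zero_add] at h1
  · refine (mul_eq_zero.1 h1).resolve_left fun hc => hXw ?_
    exact mem_degreeLT_of_coeff_eq_zero (X_mul_mem_degreeLT hw) hc
  · intro i hi
    rw [hK.moment i (Finset.mem_range.1 hi)]
    split_ifs with hi0
    · simp [hi0]
    · rw [mul_zero]

end IsReproducingPoly

namespace IsOrthogonalPoly

theorem exists_of_hankelDet_ne_zero (h : hankelDet s 1 k ≠ 0) : ∃ p, IsOrthogonalPoly s k p := by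
  obtain ⟨w, hw, hm⟩ := exists_moments_eq h fun i => -s i
  refine ⟨1 + X * w, Submodule.add_mem _ one_mem_degreeLT (X_mul_mem_degreeLT hw), by simp,
    fun i hi => ?_⟩
  rw [mul_add, map_add, ← momentFunctional_one_X_pow_mul, hm i hi, momentFunctional.X_pow_mul,
    momentFunctional.one, zero_add, add_neg_cancel]

theorem ne_zero (hp : IsOrthogonalPoly s k p) : p ≠ 0 := by
  rintro rfl
  simpa using hp.coeff_zero

theorem mul_self_pos (hp : IsOrthogonalPoly s k p) (h : IsFiniteMomentSequence s S c)
    (hk : k + 1 ≤ S.card) : 0 < momentFunctional s 0 (p * p) :=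
  (h.mul_self_nonneg p).lt_of_ne' fun h0 => hp.ne_zero (h.eq_zero_of_mul_self hk hp.mem h0)

/-- The squared norm of `p` is the reciprocal of `l_n`, and equals `r` for the last `p`. -/
theorem mul_self_eq (hp : IsOrthogonalPoly s k p) (h1 : hankelDet s 1 k ≠ 0) :
    momentFunctional s 0 (p * p) =
      hankelDet s 0 k * hankelDet s 0 (k + 1) / hankelDet s 1 k ^ 2 := by
  obtain ⟨ha, hb⟩ := hankelDet_coeff_of_orthogonal hp.mem hp.moment
  rw [momentFunctional.mul_eq_coeff_mul hp.mem hp.moment, eq_div_iff (pow_ne_zero 2 h1)]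
  rw [hp.coeff_zero, mul_one] at ha
  rw [ha] at hb ⊢
  have hs : ((-1 : ℝ) ^ k) * (-1) ^ k = 1 := by rw [← mul_pow]; simp
  linear_combination (-1) ^ k * hankelDet s 1 k * hb -
    hankelDet s 1 k ^ 2 * p.coeff k * momentFunctional s 0 (X ^ k * p) * hs

theorem hankelDet_neg_one (hp : IsOrthogonalPoly s k p) :
    hankelDet s (-1) (k + 1) = momentFunctional s (-1) p * hankelDet s 1 k := by
  refine hankelDet_succ_eq hp.mem hp.coeff_zero fun i hi => ?_
  rw [pow_succ', mul_assoc, momentFunctional.X_mul]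
  exact hp.moment i hi

end IsOrthogonalPoly

/-- The kernel `K` grows by a multiple of the orthogonal polynomial. -/
theorem IsReproducingPoly.succ_eq {K' : ℝ[X]} (hK : IsReproducingPoly s k K)
    (hK' : IsReproducingPoly s (k + 1) K') (hp : IsOrthogonalPoly s k p)
    (h : IsFiniteMomentSequence s S c) (hk : k + 1 ≤ S.card) :
    K' = K + Polynomial.C (momentFunctional s 0 (p * p))⁻¹ * p := by
  have hpos := (hp.mul_self_pos h hk).ne'
  have h1 := hK'.mul_eq hp.mem
  rw [mul_comm, momentFunctional.mul_eq_coeff_mul hK'.mem hp.moment, hp.coeff_zero] at h1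
  have h2 := momentFunctional.mul_eq_coeff_mul hp.mem hp.moment
  rw [← sub_eq_iff_eq_add]
  refine h.eq_of_moments (Nat.le_of_succ_le hk) (mem_degreeLT_of_coeff_eq_zero
    (Submodule.sub_mem _ hK'.mem ?_) ?_) hK.mem fun i hi => ?_
  · rw [← smul_eq_C_mul]
    exact Submodule.smul_mem _ _ hp.mem
  · rw [coeff_sub, coeff_C_mul]
    rw [h2] at hpos ⊢
    have := right_ne_zero_of_mul hpos
    have := left_ne_zero_of_mul hpos
    field_simp
    linear_combination h1
  · rw [mul_sub, map_sub, hK'.moment i (by omega), hK.moment i hi, ← smul_eq_C_mul, mul_smul_comm,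
      map_smul, hp.moment i hi, smul_zero, sub_zero]

theorem IsReproducingPoly.succ (hK : IsReproducingPoly s k K)
    (h : IsFiniteMomentSequence s S c) (hk : k ≤ S.card) (h0 : hankelDet s 1 k = 0) :
    IsReproducingPoly s (k + 1) K := by
  refine ⟨degreeLT_mono (Nat.le_succ k) hK.mem, fun i hi => ?_⟩
  rcases (Nat.lt_succ_iff.1 hi).lt_or_eq with hi | rfl
  · exact hK.moment i hi
  · rw [hK.moment_eq_zero h hk h0, if_neg]
    rintro rfl
    simp [hankelDet] at h0

theorem IsReproducingPoly.unique {K' : ℝ[X]} (hK : IsReproducingPoly s k K)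
    (hK' : IsReproducingPoly s k K') (h : IsFiniteMomentSequence s S c) (hk : k ≤ S.card) :
    K = K' :=
  h.eq_of_moments hk hK.mem hK'.mem fun i hi => by rw [hK.moment i hi, hK'.moment i hi]

section Step

variable {p' : ℝ[X]}

/-- Consecutive orthogonal polynomials of degrees `k` and `k + 1`. -/
theorem IsOrthogonalPoly.sub_eq_of_succ (hp : IsOrthogonalPoly s k p)
    (hp' : IsOrthogonalPoly s (k + 1) p') (hK : IsReproducingPoly s (k + 1) K)
    (h : IsFiniteMomentSequence s S c) (hk : k + 1 ≤ S.card) :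
    p - p' = Polynomial.C (momentFunctional s (-1) p - momentFunctional s (-1) p') * (X * K) ∧
      momentFunctional s (-1) p - momentFunctional s (-1) p' ≠ 0 := by
  obtain ⟨g, hg⟩ : X ∣ p - p' := X_dvd_iff.2 (by simp [hp.coeff_zero, hp'.coeff_zero])
  have hω : momentFunctional s (-1) p - momentFunctional s (-1) p' = momentFunctional s 0 g := by
    rw [← map_sub, hg, momentFunctional.X_mul]
    rfl
  rw [hω]
  have hmem : p - p' ∈ degreeLT ℝ (k + 1 + 1) :=
    Submodule.sub_mem _ (degreeLT_mono (Nat.le_succ _) hp.mem) hp'.mem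
  have hgK : g = Polynomial.C (momentFunctional s 0 g) * K := by
    refine h.eq_of_moments hk (mem_degreeLT_of_X_mul (hg ▸ hmem)) ?_ fun i hi => ?_
    · rw [← smul_eq_C_mul]
      exact Submodule.smul_mem _ _ hK.mem
    · rw [← smul_eq_C_mul, mul_smul_comm, map_smul, hK.moment i hi]
      rcases i with _ | i
      · simp
      · rw [pow_succ, mul_assoc, ← hg, mul_sub, map_sub, hp.moment i (by omega),
          hp'.moment i (by omega)]
        simp
  refine ⟨by conv_lhs => rw [hg, hgK]
             ring, fun h0 => ?_⟩
  rw [h0, C_0, zero_mul] at hgK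
  rw [hgK, mul_zero, sub_eq_zero] at hg
  exact hp'.ne_zero (h.eq_zero_of_moments hk (hg ▸ hp.mem) hp'.moment)

/-- The quotient of `Δ_{-2,k+1}` and `Δ_{0,k}` through the polynomial that represents the functional
`X ^ i ↦ -s_{i - 1}` on degrees less than `k`. -/
theorem hankelDet_neg_two (hk : hankelDet s 0 k ≠ 0) :
    ∃ y ∈ degreeLT ℝ k, (∀ i < k, momentFunctional s 0 (X ^ i * y) = -s (i - 1)) ∧
      hankelDet s (-2) (k + 1) / hankelDet s 0 k =
        s (-2) + momentFunctional s (-1) y := by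
  obtain ⟨y, hy, hm⟩ := exists_moments_eq hk fun i => -s (i - 1)
  refine ⟨y, hy, hm, ?_⟩
  rw [div_eq_iff hk, hankelDet_succ_eq (f := 1 + X * y)
    (Submodule.add_mem _ one_mem_degreeLT (X_mul_mem_degreeLT hy)) (by simp) fun i hi => ?_]
  · rw [map_add, momentFunctional.one, momentFunctional.X_mul]
    norm_num
  · rw [mul_add, map_add, mul_one, ← mul_one (X ^ (i + 1)), momentFunctional.X_pow_mul,
      momentFunctional.one, pow_succ', mul_one, mul_assoc, momentFunctional.X_mul,
      mul_left_comm, momentFunctional.X_mul,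
      show (-2 : ℤ) + 1 + 1 = 0 by norm_num, hm i hi]
    rw [show (-2 : ℤ) + ((i + 1 : ℕ) : ℤ) = i - 1 by push_cast; ring, add_neg_cancel]

/-- Consecutive orthogonal polynomials of degrees `k` and `k + 2`, when `Δ_{1,k+1}` vanishes. -/
theorem IsOrthogonalPoly.sub_eq_of_succ_succ (hp : IsOrthogonalPoly s k p)
    (hp' : IsOrthogonalPoly s (k + 2) p') (hK : IsReproducingPoly s (k + 1) K)
    (h : IsFiniteMomentSequence s S c) (hk : k + 2 ≤ S.card) (h0 : hankelDet s 1 (k + 1) = 0)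
    {υ : ℝ} (hυ : υ = hankelDet s (-2) (k + 2) / hankelDet s 0 (k + 1) -
      hankelDet s (-2) (k + 3) / hankelDet s 0 (k + 2)) :
    p - p' = (Polynomial.C (momentFunctional s (-1) p - momentFunctional s (-1) p') +
      Polynomial.C υ * X) * (X * K) ∧ 0 < υ ∧ momentFunctional s 0 (X * K) = 0 := by
  have hK2 := hK.succ h (by omega) h0
  -- `X * K` spans the orthogonal complement of the polynomials of degree at most `k` among those
  -- of degree at most `k + 1`
  have hXK : X * K ∈ degreeLT ℝ (k + 2) := X_mul_mem_degreeLT hK.mem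
  have hXKm : ∀ i < k + 1, momentFunctional s 0 (X ^ i * (X * K)) = 0 := fun i hi => by
    rw [← mul_assoc, ← pow_succ, hK2.moment (i + 1) (by omega), if_neg (Nat.succ_ne_zero i)]
  have hXK0 : momentFunctional s 0 (X * K) = 0 := by simpa using hXKm 0 (Nat.succ_pos k)
  have hK1 : momentFunctional s 0 K = 1 := by simpa using hK.moment 0 (Nat.succ_pos k)
  have hsq : 0 < momentFunctional s 0 ((X * K) * (X * K)) := by
    refine (h.mul_self_nonneg _).lt_of_ne' fun hz => ?_
    have := h.eq_zero_of_mul_self hk hXK hz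
    rw [(mul_eq_zero.1 this).resolve_left X_ne_zero] at hK1
    simp at hK1
  set e' := momentFunctional s 0 (X ^ (k + 1) * (X * K)) with he'
  have hsq2 : momentFunctional s 0 ((X * K) * (X * K)) = K.coeff k * e' := by
    rw [momentFunctional.mul_eq_coeff_mul hXK hXKm, coeff_X_mul]
  -- evaluate `L (p * K) = p(0) = 1` through the leading coefficient of `K`
  have hKp : K.coeff k * momentFunctional s 0 (X ^ k * p) = 1 := by
    rw [← momentFunctional.mul_eq_coeff_mul hK.mem hp.moment, mul_comm, hK.mul_eq hp.mem,
      hp.coeff_zero]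
  have he0 : e' ≠ 0 := by
    intro hz
    rw [hsq2, hz, mul_zero] at hsq
    exact hsq.ne' rfl
  have hKk : K.coeff k ≠ 0 := by
    intro hz
    rw [hz, zero_mul] at hKp
    exact zero_ne_one hKp
  -- `υ` is the inverse of the squared norm of `X * K`
  obtain ⟨y₁, hy₁, hm₁, hd₁⟩ := hankelDet_neg_two (h.hankelDet_zero_ne_zero (k := k + 1) (by omega))
  obtain ⟨y₂, hy₂, hm₂, hd₂⟩ := hankelDet_neg_two (h.hankelDet_zero_ne_zero hk)
  rw [hd₁, hd₂, add_sub_add_left_eq_sub, ← map_sub] at hυ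
  have hδ : y₁ - y₂ = Polynomial.C (momentFunctional s 0 (X ^ (k + 1) * (y₁ - y₂)) / e') *
      (X * K) := by
    refine h.eq_of_moments hk (Submodule.sub_mem _ (degreeLT_mono (Nat.le_succ _) hy₁) hy₂) ?_
      fun i hi => ?_
    · rw [← smul_eq_C_mul]
      exact Submodule.smul_mem _ _ hXK
    · rw [← smul_eq_C_mul, mul_smul_comm, map_smul, smul_eq_mul]
      rcases (Nat.lt_succ_iff.1 hi).lt_or_eq with hi | rfl
      · rw [hXKm i hi, mul_sub, map_sub, hm₁ i hi, hm₂ i (by omega), sub_self, mul_zero]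
      · rw [← he', div_mul_cancel₀ _ he0]
  have hυ1 : y₁ - y₂ = Polynomial.C υ * (X * K) := by
    have : υ = momentFunctional s 0 (X ^ (k + 1) * (y₁ - y₂)) / e' := by
      conv_lhs => rw [hυ, hδ]
      rw [← smul_eq_C_mul, map_smul, momentFunctional.X_mul, neg_add_cancel, hK1, smul_eq_mul,
        mul_one]
    rw [this, ← hδ]
  have hυ2 : υ * (K.coeff k * e') = 1 := by
    have h1 : momentFunctional s 0 ((X * K) * (y₁ - y₂)) = υ * (K.coeff k * e') := by
      rw [hυ1, ← smul_eq_C_mul, mul_smul_comm, map_smul, hsq2, smul_eq_mul]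
    have h2 : momentFunctional s 0 (y₁ * (X * K)) = 0 := momentFunctional.mul_eq_zero hy₁ hXKm
    have h3 : momentFunctional s 0 ((X * K) * y₂) = -momentFunctional s (-1) (X * K) := by
      rw [momentFunctional.mul_eq_sum_range hXK, momentFunctional.eq_sum_range hXK,
        ← Finset.sum_neg_distrib]
      refine Finset.sum_congr rfl fun i hi => ?_
      rw [hm₂ i (Finset.mem_range.1 hi), mul_neg]
      congr 3
    rw [← h1, mul_sub, map_sub, mul_comm _ y₁, h2, h3, momentFunctional.X_mul, neg_add_cancel, hK1]
    norm_num
  have hυpos : 0 < υ := by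
    rw [← hsq2] at hυ2
    exact pos_of_mul_pos_left (hυ2 ▸ one_pos) hsq.le
  refine ⟨?_, hυpos, hXK0⟩
  obtain ⟨g, hg⟩ : X ∣ p - p' := X_dvd_iff.2 (by simp [hp.coeff_zero, hp'.coeff_zero])
  have hω : momentFunctional s (-1) p - momentFunctional s (-1) p' = momentFunctional s 0 g := by
    rw [← map_sub, hg, momentFunctional.X_mul]
    rfl
  rw [hω]
  have hmem : p - p' ∈ degreeLT ℝ (k + 2 + 1) :=
    Submodule.sub_mem _ (degreeLT_mono (by omega) hp.mem) hp'.mem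
  have hgK : g = Polynomial.C (momentFunctional s 0 g) * K + Polynomial.C υ * (X * K) := by
    refine h.eq_of_moments hk (mem_degreeLT_of_X_mul (hg ▸ hmem)) ?_ fun i hi => ?_
    · rw [← smul_eq_C_mul, ← smul_eq_C_mul]
      exact Submodule.add_mem _ (Submodule.smul_mem _ _ hK2.mem) (Submodule.smul_mem _ _ hXK)
    · rw [← smul_eq_C_mul, ← smul_eq_C_mul, mul_add, map_add, mul_smul_comm, mul_smul_comm,
        map_smul, map_smul, hK2.moment i hi]
      rcases i with _ | i
      · rw [hXKm 0 (by omega)]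
        simp
      · rw [if_neg (Nat.succ_ne_zero i), smul_zero, zero_add, pow_succ, mul_assoc, ← hg, mul_sub,
          map_sub, hp'.moment i (by omega), sub_zero, mul_assoc, smul_eq_mul]
        rw [← mul_assoc (X ^ i), ← pow_succ]
        rcases (Nat.lt_succ_iff.1 (Nat.lt_of_succ_lt_succ hi)).lt_or_eq with hi | rfl
        · rw [hp.moment i hi, hXKm _ (by omega), mul_zero]
        · rw [← he']
          refine mul_left_cancel₀ hKk ?_
          linear_combination hKp - hυ2
  conv_lhs => rw [hg, hgK]
  ring

end Step

end FiniteMoments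

/-! ### The indices `κ(n)` -/

section Kappa

variable {s : ℤ → ℝ} {D n j : ℕ}

theorem nonzeroCount_mono (s : ℤ → ℝ) : Monotone (nonzeroCount s) := by
  classical
  intro a b h
  unfold nonzeroCount
  exact Nat.count_monotone _ (Nat.succ_le_succ h)

theorem nonzeroCount_zero (s : ℤ → ℝ) : nonzeroCount s 0 = 1 := by
  classical
  unfold nonzeroCount
  rw [Nat.count_succ, Nat.count_zero]
  simp [hankelDet]

theorem hankelDet_one_succ_eq_zero_of_nonzeroCount_le
    (h : nonzeroCount s (j + 1) ≤ nonzeroCount s j) : hankelDet s 1 (j + 1) = 0 := by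
  classical
  by_contra h0
  unfold nonzeroCount at h
  rw [Nat.count_succ _ (j + 1), if_pos h0] at h
  omega

theorem nonzeroCount_succ_of_hankelDet_eq_zero (h : hankelDet s 1 (j + 1) = 0) :
    nonzeroCount s (j + 1) = nonzeroCount s j := by
  classical
  unfold nonzeroCount
  rw [Nat.count_succ _ (j + 1), if_neg (not_not.2 h), add_zero]

theorem kappa_le_of_nonzeroCount_eq (h : nonzeroCount s j = n) : kappa s n ≤ j :=
  Nat.sInf_le h

theorem kappa_one (s : ℤ → ℝ) : kappa s 1 = 0 :=
  Nat.le_zero.1 (kappa_le_of_nonzeroCount_eq (nonzeroCount_zero s))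

theorem hankelDet_one_kappa_ne_zero (h1 : 1 ≤ n) (hn : n ≤ cfLength s D + 1) :
    hankelDet s 1 (kappa s n) ≠ 0 := by
  have hs := (kappa_spec s D n h1 hn).1
  intro h0
  rcases hk : kappa s n with _ | k
  · rw [hk] at h0
    simp [hankelDet] at h0
  · rw [hk] at h0 hs
    rw [nonzeroCount_succ_of_hankelDet_eq_zero h0] at hs
    have := kappa_le_of_nonzeroCount_eq hs
    omega

theorem kappa_lt_kappa_succ (h1 : 1 ≤ n) (hn : n ≤ cfLength s D) :
    kappa s n < kappa s (n + 1) := by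
  have ha := (kappa_spec s D n h1 (by omega)).1
  have hb := (kappa_spec s D (n + 1) (by omega) (by omega)).1
  by_contra! h
  have := nonzeroCount_mono s h
  omega

theorem hankelDet_one_eq_zero_of_kappa_lt (h1 : 1 ≤ n) (hn : n ≤ cfLength s D)
    (hj : kappa s n < j) (hj' : j < kappa s (n + 1)) : hankelDet s 1 j = 0 := by
  have ha := (kappa_spec s D n h1 (by omega)).1
  have hb := (kappa_spec s D (n + 1) (by omega) (by omega)).1
  obtain ⟨i, rfl⟩ : ∃ i, j = i + 1 := ⟨j - 1, by omega⟩
  refine hankelDet_one_succ_eq_zero_of_nonzeroCount_le ?_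
  have h3 := nonzeroCount_mono s (show kappa s n ≤ i by omega)
  have h4 := nonzeroCount_mono s hj'.le
  have h5 : nonzeroCount s (i + 1) ≠ n + 1 := fun h => by
    have := kappa_le_of_nonzeroCount_eq h
    omega
  omega

theorem hankelDet_one_eq_zero_of_kappa_last_lt (hj : kappa s (cfLength s D + 1) < j)
    (hj' : j ≤ D) : hankelDet s 1 j = 0 := by
  have ha := (kappa_spec s D (cfLength s D + 1) (by omega) le_rfl).1
  obtain ⟨i, rfl⟩ : ∃ i, j = i + 1 := ⟨j - 1, by omega⟩
  refine hankelDet_one_succ_eq_zero_of_nonzeroCount_le ?_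
  have h3 := nonzeroCount_mono s (show kappa s (cfLength s D + 1) ≤ i by omega)
  have h4 := nonzeroCount_mono s hj'
  rw [cfLength_add_one s D] at h4
  omega

end Kappa

section KappaFinite

variable {s : ℤ → ℝ} {S : Finset ℝ} {c : ℝ → ℝ} {D n : ℕ}

theorem IsFiniteMomentSequence.kappa_le (h : IsFiniteMomentSequence s S c) (h1 : 1 ≤ n)
    (hn : n ≤ cfLength s D + 1) : kappa s n ≤ S.card := by
  by_contra! hlt
  exact hankelDet_one_kappa_ne_zero h1 hn (h.hankelDet_one_eq_zero hlt)

/-- Consecutive values of `κ` differ by one or two. -/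
theorem IsFiniteMomentSequence.kappa_succ (h : IsFiniteMomentSequence s S c) (h1 : 1 ≤ n)
    (hn : n ≤ cfLength s D) : kappa s (n + 1) = kappa s n + 1 ∨
      (kappa s (n + 1) = kappa s n + 2 ∧ hankelDet s 1 (kappa s n + 1) = 0) := by
  have hlt := kappa_lt_kappa_succ h1 hn
  have hle := h.kappa_le (n := n + 1) (by omega) (D := D) (by omega)
  rcases eq_or_ne (kappa s (n + 1)) (kappa s n + 1) with h2 | h2
  · exact Or.inl h2
  · have h3 := hankelDet_one_eq_zero_of_kappa_lt h1 hn (Nat.lt_succ_self _) (by omega)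
    refine Or.inr ⟨?_, h3⟩
    by_contra h4
    have h5 := hankelDet_one_eq_zero_of_kappa_lt (j := kappa s n + 2) h1 hn (by omega) (by omega)
    exact (h.hankelDet_one_ne_zero_or (k := kappa s n + 1) (by omega)).elim (· h3) (· h5)

/-- The last value of `κ` is `#S` or `#S - 1`. -/
theorem IsFiniteMomentSequence.kappa_last (h : IsFiniteMomentSequence s S c) (hD : S.card ≤ D) :
    kappa s (cfLength s D + 1) = S.card ∨
      (kappa s (cfLength s D + 1) + 1 = S.card ∧ hankelDet s 1 S.card = 0) := by
  have hle := h.kappa_le (n := cfLength s D + 1) (by omega) le_rfl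
  rcases hle.eq_or_lt with h2 | h2
  · exact Or.inl h2
  · have h3 := hankelDet_one_eq_zero_of_kappa_last_lt h2 hD
    refine Or.inr ⟨?_, h3⟩
    by_contra h4
    have h5 := hankelDet_one_eq_zero_of_kappa_last_lt (j := S.card - 1) (D := D) (s := s)
      (by omega) (by omega)
    have h6 := h.hankelDet_one_ne_zero_or (k := S.card - 1) (by omega)
    rw [Nat.sub_add_cancel (by omega)] at h6
    exact h6.elim (· h5) (· h3)

end KappaFinite

/-! ### Recursions for continued fractions -/

section Tail

variable {υ ω l : ℕ → ℝ} {r : ℝ} {z : ℂ}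

/-- Adding `υ z + ω` to a number on the same side of the real line as `z` gives a non-zero
number on that side. -/
theorem cf_partial_denominator {u w : ℝ} {q : ℂ} (hz : z.im ≠ 0) (hq : 0 ≤ z.im * q.im)
    (hq0 : z.im * q.im = 0 → q = 0) (hu : 0 ≤ u) (hne : 0 < u ∨ w ≠ 0) :
    0 ≤ z.im * (u * z + w + q).im ∧ u * z + w + q ≠ 0 := by
  have him : z.im * (u * z + w + q).im = u * z.im ^ 2 + z.im * q.im := by
    simp
    ring
  have hz2 : 0 < z.im ^ 2 := by positivity
  refine ⟨by rw [him]; positivity, fun h0 => ?_⟩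
  rw [h0, Complex.zero_im, mul_zero] at him
  have h1 : 0 ≤ u * z.im ^ 2 := by positivity
  have hu0 : u = 0 := by
    have : u * z.im ^ 2 = 0 := by linarith
    exact (mul_eq_zero.1 this).resolve_right hz2.ne'
  have hqz := hq0 (by linarith)
  rw [hu0, hqz] at h0
  simp only [Complex.ofReal_zero, zero_mul, zero_add, add_zero, Complex.ofReal_eq_zero] at h0
  exact hne.elim (fun h => h.ne' hu0) (fun h => h h0)

theorem cf_denominator_im {a : ℝ} {W : ℂ} (hz : z.im ≠ 0) (hW : 0 ≤ z.im * W.im) (ha : 0 < a) :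
    z.im * (-(a * z) + 1 / W).im < 0 := by
  have him : z.im * (-(a * z) + 1 / W).im =
      -(a * z.im ^ 2) - (z.im * W.im) / Complex.normSq W := by
    simp [Complex.inv_im]
    ring
  rw [him]
  have h1 : 0 ≤ (z.im * W.im) / Complex.normSq W := div_nonneg hW (Complex.normSq_nonneg _)
  have h2 : 0 < a * z.im ^ 2 := by positivity
  linarith

theorem cf_inv_im {V : ℂ} (hV : z.im * V.im < 0) : 0 < z.im * (1 / V).im := by
  have hV0 : V ≠ 0 := by
    rintro rfl
    simp at hV
  have him : z.im * (1 / V).im = -(z.im * V.im) / Complex.normSq V := by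
    simp [Complex.inv_im]
    ring
  rw [him]
  exact div_pos (neg_pos.2 hV) (Complex.normSq_pos.2 hV0)

/-- The tails of a continued fraction with the given sign conditions map the upper and the lower
half-plane into themselves, unless they vanish. -/
theorem cfTail_im (hz : z.im ≠ 0) (hr : 0 ≤ r) (j n : ℕ)
    (hυ : ∀ i, n ≤ i → i < n + j → 0 ≤ υ i)
    (hne : ∀ i, n ≤ i → i < n + j → 0 < υ i ∨ ω i ≠ 0)
    (hl : ∀ i, n ≤ i → i < n + j → 0 < l i) :
    0 ≤ z.im * (cfTail υ ω l r z j n).im ∧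
      (z.im * (cfTail υ ω l r z j n).im = 0 → cfTail υ ω l r z j n = 0) := by
  induction j generalizing n with
  | zero =>
    have hz0 : z ≠ 0 := by
      rintro rfl
      simp at hz
    have hn := Complex.normSq_pos.2 hz0
    have him : z.im * (cfTail υ ω l r z 0 n).im = r * (z.im ^ 2 / Complex.normSq z) := by
      simp only [cfTail, Complex.neg_im, Complex.div_im, Complex.ofReal_re, Complex.ofReal_im]
      ring
    have hp : 0 < z.im ^ 2 / Complex.normSq z := by positivity
    rw [him]
    refine ⟨by positivity, fun h => ?_⟩
    have hr0 := (mul_eq_zero.1 h).resolve_right hp.ne'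
    simp [cfTail, hr0]
  | succ j ih =>
    have h1 := ih (n + 1) (fun i hi hi' => hυ i (by omega) (by omega))
      (fun i hi hi' => hne i (by omega) (by omega)) (fun i hi hi' => hl i (by omega) (by omega))
    have h2 := cf_partial_denominator hz h1.1 h1.2 (hυ n le_rfl (by omega))
      (hne n le_rfl (by omega))
    have h3 := cf_inv_im (cf_denominator_im hz h2.1 (hl n le_rfl (by omega)))
    exact ⟨h3.le, fun h => absurd h h3.ne'⟩

/-- A solution `(T, U)` of the recursion of a continued fraction with the right final value
represents the continued fraction as the quotient `T / U`. -/
theorem cfTail_of_recursion (hz : z.im ≠ 0) {N : ℕ} (hr : 0 ≤ r)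
    (hυ : ∀ i, 1 ≤ i → i ≤ N → 0 ≤ υ i)
    (hne : ∀ i, 1 ≤ i → i ≤ N → 0 < υ i ∨ ω i ≠ 0)
    (hl : ∀ i, 1 ≤ i → i ≤ N → 0 < l i) {T U : ℕ → ℂ}
    (hU : ∀ i, 1 ≤ i → i ≤ N → U (i + 1) = U i + l i * z * T i)
    (hT : ∀ i, 1 ≤ i → i ≤ N → T i - T (i + 1) = (ω i + υ i * z) * U (i + 1))
    (hend : T (N + 1) = -(r / z) * U (N + 1)) :
    CFWellDefined υ ω l r N z ∧ T 1 = cfTail υ ω l r z N 1 * U 1 := by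
  have hwd : CFWellDefined υ ω l r N z := by
    intro n h1 hn
    have h2 := cfTail_im (υ := υ) (ω := ω) (l := l) hz hr (N - n) (n + 1)
      (fun i hi hi' => hυ i (by omega) (by omega)) (fun i hi hi' => hne i (by omega) (by omega))
      (fun i hi hi' => hl i (by omega) (by omega))
    have h3 := cf_partial_denominator hz h2.1 h2.2 (hυ n h1 hn) (hne n h1 hn)
    refine ⟨h3.2, fun h0 => ?_⟩
    have h4 := cf_denominator_im hz h3.1 (hl n h1 hn)
    rw [h0] at h4
    simp at h4
  refine ⟨hwd, ?_⟩
  have key : ∀ j ≤ N, T (N + 1 - j) = cfTail υ ω l r z j (N + 1 - j) * U (N + 1 - j) := by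
    intro j
    induction j with
    | zero =>
      intro _
      exact hend
    | succ j ih =>
      intro hj
      have hn1 : 1 ≤ N - j := by omega
      have ih := ih (by omega)
      rw [show N + 1 - j = N - j + 1 by omega] at ih
      rw [show N + 1 - (j + 1) = N - j by omega]
      obtain ⟨hW, hV⟩ := hwd (N - j) hn1 (by omega)
      have hU := hU (N - j) hn1 (by omega)
      have hT := hT (N - j) hn1 (by omega)
      rw [show N - (N - j) = j by omega] at hW hV
      rw [cfTail]
      rw [ih] at hT
      set q := cfTail υ ω l r z j (N - j + 1)
      set W := υ (N - j) * z + ω (N - j) + q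
      have hV' : -(l (N - j) * z) * W + 1 ≠ 0 := by
        intro h0
        apply hV
        field_simp
        linear_combination h0
      have hq : 1 / (-(l (N - j) * z) + 1 / W) = W / (-(l (N - j) * z) * W + 1) := by
        field_simp
      rw [hq, div_mul_eq_mul_div, eq_div_iff hV']
      have : T (N - j) = W * U (N - j + 1) := by linear_combination hT
      rw [hU] at this
      linear_combination this
  have := key N le_rfl
  rwa [Nat.add_sub_cancel_left] at this

end Tail

/-! ### The Cauchy transform and the expansion -/

section Cauchy

open Polynomial

/-- The linear map `f ↦ ∫ f(λ) / (λ - z) dρ(λ)` on polynomials, for `ρ = ∑ x ∈ S, c x • δ_x`. -/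
noncomputable def cauchyTransform (S : Finset ℝ) (c : ℝ → ℝ) (z : ℂ) : ℝ[X] →ₗ[ℝ] ℂ where
  toFun f := ∑ x ∈ S, (c x : ℂ) * ((f.eval x : ℝ) : ℂ) / (x - z)
  map_add' f g := by
    rw [← Finset.sum_add_distrib]
    refine Finset.sum_congr rfl fun x _ => ?_
    rw [eval_add]
    push_cast
    ring
  map_smul' a f := by
    rw [Finset.smul_sum]
    refine Finset.sum_congr rfl fun x _ => ?_
    rw [eval_smul, smul_eq_mul, RingHom.id_apply, Complex.real_smul]
    push_cast
    ring

variable {s : ℤ → ℝ} {S : Finset ℝ} {c : ℝ → ℝ} {z : ℂ}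

theorem cauchyTransform_apply (f : ℝ[X]) :
    cauchyTransform S c z f = ∑ x ∈ S, (c x : ℂ) * ((f.eval x : ℝ) : ℂ) / (x - z) := rfl

theorem cauchyTransform_eq_zero {f : ℝ[X]} (h : ∀ x ∈ S, f.eval x = 0) :
    cauchyTransform S c z f = 0 := by
  rw [cauchyTransform_apply]
  exact Finset.sum_eq_zero fun x hx => by simp [h x hx]

theorem cauchyTransform_X_mul (h : IsFiniteMomentSequence s S c) (hz : z.im ≠ 0) (f : ℝ[X]) :
    cauchyTransform S c z (X * f) = momentFunctional s 0 f + z * cauchyTransform S c z f := by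
  rw [h.apply, cauchyTransform_apply, cauchyTransform_apply, Finset.mul_sum]
  push_cast
  rw [← Finset.sum_add_distrib]
  refine Finset.sum_congr rfl fun x _ => ?_
  have : (x : ℂ) - z ≠ 0 := by
    intro h0
    apply hz
    rw [← sub_eq_zero.1 h0, Complex.ofReal_im]
  rw [eval_mul, eval_X]
  push_cast
  field_simp
  ring

theorem cauchyTransform_C_mul (a : ℝ) (f : ℝ[X]) :
    cauchyTransform S c z (Polynomial.C a * f) = a * cauchyTransform S c z f := by
  rw [← smul_eq_C_mul, map_smul, Complex.real_smul]

end Cauchy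

section Expansion

open Polynomial

variable {s : ℤ → ℝ} {S : Finset ℝ} {c : ℝ → ℝ}

theorem hankelDet_zero_right (s : ℤ → ℝ) (j : ℤ) : hankelDet s j 0 = 1 := by
  simp [hankelDet]

theorem hankelDet_one_right (s : ℤ → ℝ) (j : ℤ) : hankelDet s j 1 = s j := by
  simp [hankelDet]

/-- The relation between consecutive orthogonal polynomials that yields one level of the continued
fraction. The last clause removes the term `υ L (X K)` that arises when `X` is pulled out of the
Cauchy transform. -/
theorem IsFiniteMomentSequence.sub_eq (h : IsFiniteMomentSequence s S c) {D n : ℕ} (h1 : 1 ≤ n)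
    (hn : n ≤ cfLength s D) {p p' K : ℝ[X]} (hp : IsOrthogonalPoly s (kappa s n) p)
    (hp' : IsOrthogonalPoly s (kappa s (n + 1)) p') (hK : IsReproducingPoly s (kappa s n + 1) K)
    {υ ω : ℝ}
    (hυ : υ = hankelDet s (-2) (kappa s n + 2) / hankelDet s 0 (kappa s n + 1) -
      hankelDet s (-2) (kappa s (n + 1) + 1) / hankelDet s 0 (kappa s (n + 1)))
    (hω : ω = hankelDet s (-1) (kappa s n + 1) / hankelDet s 1 (kappa s n) -
      hankelDet s (-1) (kappa s (n + 1) + 1) / hankelDet s 1 (kappa s (n + 1))) :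
    p - p' = (Polynomial.C ω + Polynomial.C υ * X) * (X * K) ∧ 0 ≤ υ ∧ (0 < υ ∨ ω ≠ 0) ∧
      υ * momentFunctional s 0 (X * K) = 0 := by
  have hne := hankelDet_one_kappa_ne_zero (s := s) (D := D) h1 (by omega)
  have hne' := hankelDet_one_kappa_ne_zero (s := s) (n := n + 1) (D := D) (by omega) (by omega)
  rw [hp.hankelDet_neg_one, hp'.hankelDet_neg_one, mul_div_cancel_right₀ _ hne,
    mul_div_cancel_right₀ _ hne'] at hω
  have hle := h.kappa_le (n := n + 1) (D := D) (by omega) (by omega)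
  rcases h.kappa_succ h1 hn with hk | ⟨hk, h0⟩
  · rw [hk] at hυ hp' hle
    rw [sub_self] at hυ
    obtain ⟨ha, hb⟩ := hp.sub_eq_of_succ hp' hK h hle
    rw [← hω] at ha hb
    refine ⟨?_, hυ.ge, Or.inr hb, by rw [hυ, zero_mul]⟩
    rw [ha, hυ, C_0, zero_mul, add_zero]
  · rw [hk] at hυ hp' hle
    obtain ⟨ha, hb, hc⟩ := hp.sub_eq_of_succ_succ hp' hK h hle h0 hυ
    rw [← hω] at ha
    exact ⟨ha, hb.le, Or.inl hb, by rw [hc, mul_zero]⟩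

/-- The continued fraction expansion of `-s_{-2} z - s_{-1} + ∑ x ∈ S, c x / (x - z)`. -/
theorem IsFiniteMomentSequence.continuedFraction (h : IsFiniteMomentSequence s S c) {D : ℕ}
    (hD : S.card ≤ D) (hs : s (-2) ≤ 0) (Δ : ℤ → ℕ → ℝ) (κ : ℕ → ℕ) (N : ℕ)
    (hΔ : Δ = hankelDet s) (hκ : κ = kappa s) (hN : N = cfLength s D) :
    (∀ n : ℕ, 1 ≤ n → n ≤ N + 1 → Δ 0 (κ n) ≠ 0 ∧ Δ 1 (κ n) ≠ 0) ∧
    (∀ n : ℕ, 1 ≤ n → n ≤ N → Δ 0 (κ n + 1) ≠ 0) ∧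
    ∃ (υ ω l : ℕ → ℝ) (r : ℝ),
      υ 0 = -(Δ (-2) 1 / Δ 0 0) ∧
      (∀ n : ℕ, 1 ≤ n → n ≤ N →
        υ n = Δ (-2) (κ n + 2) / Δ 0 (κ n + 1)
          - Δ (-2) (κ (n + 1) + 1) / Δ 0 (κ (n + 1))) ∧
      ω 0 = -(Δ (-1) 1 / Δ 1 0) ∧
      (∀ n : ℕ, 1 ≤ n → n ≤ N →
        ω n = Δ (-1) (κ n + 1) / Δ 1 (κ n)
          - Δ (-1) (κ (n + 1) + 1) / Δ 1 (κ (n + 1))) ∧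
      (∀ n : ℕ, 1 ≤ n → n ≤ N →
        l n = Δ 1 (κ n) ^ 2 / (Δ 0 (κ n) * Δ 0 (κ n + 1))) ∧
      r = Δ 0 (κ (N + 1)) * Δ 0 (κ (N + 1) + 1) / Δ 1 (κ (N + 1)) ^ 2 ∧
      (∀ n : ℕ, n ≤ N → 0 ≤ υ n) ∧
      (∀ n : ℕ, 1 ≤ n → n ≤ N → 0 < l n) ∧
      0 ≤ r ∧
      ∀ z : ℂ, z.im ≠ 0 → CFWellDefined υ ω l r N z ∧
        -s (-2) * z + -s (-1) + cauchyTransform S c z 1 = cfValue υ ω l r N z := by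
  subst hΔ hκ hN
  have hle : ∀ n, 1 ≤ n → n ≤ cfLength s D + 1 → kappa s n ≤ S.card := fun n h1 hn =>
    h.kappa_le h1 hn
  have hlt : ∀ n, 1 ≤ n → n ≤ cfLength s D → kappa s n + 1 ≤ S.card := fun n h1 hn =>
    (kappa_lt_kappa_succ h1 hn).trans_le (hle (n + 1) (by omega) (by omega))
  have hne : ∀ n, 1 ≤ n → n ≤ cfLength s D + 1 → hankelDet s 1 (kappa s n) ≠ 0 := fun n h1 hn =>
    hankelDet_one_kappa_ne_zero h1 hn
  refine ⟨fun n h1 hn => ⟨h.hankelDet_zero_ne_zero (hle n h1 hn), hne n h1 hn⟩,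
    fun n h1 hn => h.hankelDet_zero_ne_zero (hlt n h1 hn), ?_⟩
  have hp : ∀ n, ∃ p, 1 ≤ n → n ≤ cfLength s D + 1 → IsOrthogonalPoly s (kappa s n) p := fun n => by
    by_cases hn : 1 ≤ n ∧ n ≤ cfLength s D + 1
    · obtain ⟨p, hp⟩ := IsOrthogonalPoly.exists_of_hankelDet_ne_zero (hne n hn.1 hn.2)
      exact ⟨p, fun _ _ => hp⟩
    · exact ⟨0, fun h1 h2 => absurd ⟨h1, h2⟩ hn⟩
  choose p hp using hp
  have hK : ∀ k, ∃ K, k ≤ S.card → IsReproducingPoly s k K := fun k => by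
    by_cases hk : k ≤ S.card
    · obtain ⟨K, hK⟩ := IsReproducingPoly.exists_of_le h hk
      exact ⟨K, fun _ => hK⟩
    · exact ⟨0, fun h1 => absurd h1 hk⟩
  choose K hK using hK
  have hKk : ∀ n, 1 ≤ n → n ≤ cfLength s D → K (kappa s (n + 1)) = K (kappa s n + 1) := by
    intro n h1 hn
    rcases h.kappa_succ h1 hn with hk | ⟨hk, h0⟩
    · rw [hk]
    · have := hle (n + 1) (by omega) (by omega)
      rw [hk] at this ⊢
      exact (hK _ this).unique ((hK _ (hlt n h1 hn)).succ h (hlt n h1 hn) h0) h this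
  set υ : ℕ → ℝ := fun n => if n = 0 then -(hankelDet s (-2) 1 / hankelDet s 0 0) else
    hankelDet s (-2) (kappa s n + 2) / hankelDet s 0 (kappa s n + 1) -
      hankelDet s (-2) (kappa s (n + 1) + 1) / hankelDet s 0 (kappa s (n + 1)) with hυ
  set ω : ℕ → ℝ := fun n => if n = 0 then -(hankelDet s (-1) 1 / hankelDet s 1 0) else
    hankelDet s (-1) (kappa s n + 1) / hankelDet s 1 (kappa s n) -
      hankelDet s (-1) (kappa s (n + 1) + 1) / hankelDet s 1 (kappa s (n + 1)) with hω
  set l : ℕ → ℝ := fun n => hankelDet s 1 (kappa s n) ^ 2 /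
    (hankelDet s 0 (kappa s n) * hankelDet s 0 (kappa s n + 1)) with hl
  set r : ℝ := hankelDet s 0 (kappa s (cfLength s D + 1)) *
    hankelDet s 0 (kappa s (cfLength s D + 1) + 1) /
      hankelDet s 1 (kappa s (cfLength s D + 1)) ^ 2 with hr
  have hυn : ∀ n, 1 ≤ n → υ n = hankelDet s (-2) (kappa s n + 2) / hankelDet s 0 (kappa s n + 1) -
      hankelDet s (-2) (kappa s (n + 1) + 1) / hankelDet s 0 (kappa s (n + 1)) := fun n h1 =>
    if_neg (by omega)
  have hωn : ∀ n, 1 ≤ n → ω n = hankelDet s (-1) (kappa s n + 1) / hankelDet s 1 (kappa s n) -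
      hankelDet s (-1) (kappa s (n + 1) + 1) / hankelDet s 1 (kappa s (n + 1)) := fun n h1 =>
    if_neg (by omega)
  have hυ0 : υ 0 = -s (-2) := by
    simp [hυ, hankelDet_one_right, hankelDet_zero_right]
  have hω0 : ω 0 = -s (-1) := by
    simp [hω, hankelDet_one_right, hankelDet_zero_right]
  have hstep := fun n (h1 : 1 ≤ n) (hn : n ≤ cfLength s D) =>
    h.sub_eq h1 hn (hp n h1 (by omega)) (hp (n + 1) (by omega) (by omega)) (hK _ (hlt n h1 hn))
      (hυn n h1) (hωn n h1)
  have hlp : ∀ n, 1 ≤ n → n ≤ cfLength s D →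
      l n = (momentFunctional s 0 (p n * p n))⁻¹ := fun n h1 hn => by
    rw [(hp n h1 (by omega)).mul_self_eq (hne n h1 (by omega)), inv_div]
  have hrp : r = momentFunctional s 0 (p (cfLength s D + 1) * p (cfLength s D + 1)) :=
    ((hp _ (by omega) le_rfl).mul_self_eq (hne _ (by omega) le_rfl)).symm
  have hlpos : ∀ n, 1 ≤ n → n ≤ cfLength s D → 0 < l n := fun n h1 hn => by
    rw [hlp n h1 hn]
    exact inv_pos.2 ((hp n h1 (by omega)).mul_self_pos h (hlt n h1 hn))
  have hrnn : 0 ≤ r := by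
    rw [hrp]
    exact h.mul_self_nonneg _
  refine ⟨υ, ω, l, r, if_pos rfl, fun n h1 _ => hυn n h1, if_pos rfl, fun n h1 _ => hωn n h1,
    fun n _ _ => rfl, rfl, fun n hn => ?_, hlpos, hrnn, fun z hz => ?_⟩
  · rcases Nat.eq_zero_or_pos n with rfl | h1
    · rw [hυ0]
      linarith
    · exact (hstep n h1 hn).2.1
  have hz0 : z ≠ 0 := by
    rintro rfl
    simp at hz
  have hrec := cfTail_of_recursion (υ := υ) (ω := ω) (l := l) (r := r) hz
    (N := cfLength s D) hrnn
    (fun i h1 hi => (hstep i h1 hi).2.1) (fun i h1 hi => (hstep i h1 hi).2.2.1) hlpos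
    (T := fun n => cauchyTransform S c z (p n))
    (U := fun n => 1 + z * cauchyTransform S c z (K (kappa s n))) ?_ ?_ ?_
  · refine ⟨hrec.1, ?_⟩
    have hval := hrec.2
    have hp1 : p 1 = 1 := by
      have := hp 1 le_rfl (by omega)
      rw [kappa_one] at this
      have h1 := eq_C_of_degree_le_zero (p := p 1) (by
        have := mem_degreeLT.1 this.mem
        exact Nat.WithBot.lt_one_iff_le_zero.1 (by simpa using this))
      rw [h1, this.coeff_zero, C_1]
    have hK0 : K (kappa s 1) = 0 := by
      rw [kappa_one]
      exact (hK 0 (Nat.zero_le _)).eq_zero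
    simp only [hp1, hK0, map_zero, mul_zero, add_zero, mul_one] at hval
    rw [cfValue, hval, hυ0, hω0]
    push_cast
    rfl
  · intro n h1 hn
    rw [hKk n h1 hn, (hK _ (hle n h1 (by omega))).succ_eq (hK _ (hlt n h1 hn))
      (hp n h1 (by omega)) h (hlt n h1 hn), ← hlp n h1 hn, map_add, cauchyTransform_C_mul]
    ring
  · intro n h1 hn
    obtain ⟨ha, -, -, hc⟩ := hstep n h1 hn
    have hK1 : momentFunctional s 0 (K (kappa s n + 1)) = 1 := by
      simpa using (hK _ (hlt n h1 hn)).moment 0 (Nat.succ_pos _)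
    have hc' : (υ n : ℂ) * (momentFunctional s 0 (X * K (kappa s n + 1)) : ℂ) = 0 := by
      exact_mod_cast hc
    rw [hKk n h1 hn, ← map_sub, ha, add_mul, map_add, cauchyTransform_C_mul, mul_assoc,
      cauchyTransform_C_mul, cauchyTransform_X_mul h hz (X * _), cauchyTransform_X_mul h hz (K _),
      hK1]
    push_cast
    linear_combination hc'
  · have hpl := hp (cfLength s D + 1) (by omega) le_rfl
    rcases h.kappa_last hD with hk | ⟨hk, h0⟩
    · -- the last orthogonal polynomial vanishes on `S`
      rw [hk] at hpl
      have hev : ∀ x ∈ S, (p (cfLength s D + 1)).eval x = 0 := fun x hx =>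
        h.eval_eq_zero_of_moments hpl.moment hx
      have hr0 : r = 0 := by
        rw [hrp, h.apply]
        exact Finset.sum_eq_zero fun x hx => by simp [hev x hx]
      rw [cauchyTransform_eq_zero hev, hr0]
      simp
    · -- `X` times the kernel vanishes on `S`
      have hKd := hK _ le_rfl
      have hKs := hKd.succ h le_rfl h0
      have hev : ∀ x ∈ S, (X * K S.card).eval x = 0 := fun x hx =>
        h.eval_eq_zero_of_moments (fun i hi => by
          rw [← mul_assoc, ← pow_succ, hKs.moment (i + 1) (by omega),
            if_neg (Nat.succ_ne_zero i)]) hx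
      have hK1 : momentFunctional s 0 (K S.card) = 1 := by
        simpa using hKd.moment 0 (by omega)
      have h2 := cauchyTransform_eq_zero (c := c) (z := z) hev
      have hle1 : kappa s (cfLength s D + 1) + 1 ≤ S.card := hk.le
      rw [cauchyTransform_X_mul h hz, hK1, ← hk,
        (hK _ (by omega)).succ_eq (hK _ hle1) hpl h hle1, map_add, cauchyTransform_C_mul,
        ← hrp] at h2
      have hrne : (r : ℂ) ≠ 0 := by
        rw [hrp]
        exact_mod_cast (hpl.mul_self_pos h hle1).ne'
      push_cast at h2
      field_simp at h2 ⊢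
      linear_combination h2

end Expansion

/-! ### Rational Herglotz–Nevanlinna functions -/

section PowerSign

open Complex

/-- A monomial `c w ^ k` with `k ≥ 1` that maps the upper half-plane into its closure is linear with
positive slope. -/
theorem eq_one_of_im_mul_pow_nonneg {k : ℕ} (hk : k ≠ 0) {c : ℂ} (hc : c ≠ 0)
    (h : ∀ w : ℂ, 0 < w.im → 0 ≤ (c * w ^ k).im) : k = 1 ∧ c.im = 0 ∧ 0 < c.re := by
  have h' : ∀ w : ℂ, 0 ≤ w.im → 0 ≤ (c * w ^ k).im := by
    intro w hw
    have hcont : Continuous fun t : ℝ => (c * (w + t * I) ^ k).im := by fun_prop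
    have ht := (hcont.tendsto 0).mono_left (nhdsWithin_le_nhds (s := Set.Ioi (0 : ℝ)))
    simp only [ofReal_zero, zero_mul, add_zero] at ht
    refine ge_of_tendsto ht ?_
    filter_upwards [self_mem_nhdsWithin] with t ht
    refine h _ ?_
    have : 0 < t := ht
    simp
    linarith
  have hk0 : (0 : ℝ) < k := by exact_mod_cast Nat.pos_of_ne_zero hk
  have hkc : (k : ℂ) ≠ 0 := by exact_mod_cast hk
  have hexp : ∀ θ : ℝ, 0 ≤ θ → θ ≤ k * Real.pi → 0 ≤ (c * exp (θ * I)).im := by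
    intro θ h0 h1
    have h2 := h' (exp ((θ / k : ℝ) * I)) (by
      rw [exp_ofReal_mul_I_im]
      refine Real.sin_nonneg_of_nonneg_of_le_pi (by positivity) ?_
      rw [div_le_iff₀ hk0]
      linarith)
    rw [← exp_nat_mul] at h2
    convert h2 using 4
    push_cast
    field_simp
  have hpi := Real.pi_pos
  have hk1 : (1 : ℝ) ≤ k := by exact_mod_cast Nat.one_le_iff_ne_zero.2 hk
  have ha := hexp 0 le_rfl (by positivity)
  have hb := hexp Real.pi hpi.le (by nlinarith)
  -- the angles `0`, `π` and `π / 2` give `c.im = 0 ≤ c.re`; for `k ≥ 2` also `3 π / 2` is available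
  have hd := hexp (Real.pi / 2) (by positivity) (by nlinarith)
  rw [exp_pi_mul_I] at hb
  have he : exp (((Real.pi / 2 : ℝ) : ℂ) * I) = I := by
    push_cast
    exact exp_pi_div_two_mul_I
  rw [he] at hd
  simp at ha hb hd
  have him : c.im = 0 := le_antisymm hb ha
  have hre : 0 < c.re := by
    refine hd.lt_of_ne' fun h0 => hc ?_
    exact Complex.ext h0 him
  refine ⟨?_, him, hre⟩
  by_contra hne
  have hk2 : (2 : ℝ) ≤ k := by exact_mod_cast (by omega : 2 ≤ k)
  have hf := hexp (Real.pi + Real.pi / 2) (by positivity) (by nlinarith)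
  rw [ofReal_add, add_mul, exp_add, he, exp_pi_mul_I] at hf
  simp at hf
  linarith

end PowerSign

section Rational

open Polynomial Filter Topology

variable {m : ℂ → ℂ} {n q : ℂ[X]}

theorem eventually_eval_ne_zero (hq : q ≠ 0) (z : ℂ) : ∀ᶠ w in 𝓝[≠] z, q.eval w ≠ 0 := by
  have hfin : ({w | q.IsRoot w} \ {z}).Finite :=
    (finite_setOfPred_isRoot hq).subset Set.sdiff_subset
  filter_upwards [mem_nhdsWithin_of_mem_nhds (hfin.isClosed.compl_mem_nhds (x := z) (by simp)),
    self_mem_nhdsWithin] with w hw hne h0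
  exact hw ⟨h0, hne⟩

/-- Continuity excludes non-real poles. -/
theorem IsHerglotzNevanlinna.denom_eval_ne_zero (hm : IsHerglotzNevanlinna m)
    (hnq : IsCoprime n q) (hq : q ≠ 0) (h : ∀ z : ℂ, z.im ≠ 0 → m z = n.eval z / q.eval z)
    {z : ℂ} (hz : z.im ≠ 0) : q.eval z ≠ 0 := by
  intro h0
  have hopen : IsOpen {z : ℂ | z.im ≠ 0} := isOpen_ne_fun Complex.continuous_im continuous_const
  have hc : ContinuousAt m z := (hm.analytic z hz).continuousAt
  have h1 : Tendsto (fun w => m w * q.eval w) (𝓝[≠] z) (𝓝 (m z * q.eval z)) :=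
    (hc.mul q.continuous.continuousAt).tendsto.mono_left nhdsWithin_le_nhds
  have h2 : Tendsto (fun w => n.eval w) (𝓝[≠] z) (𝓝 (n.eval z)) :=
    n.continuous.continuousAt.tendsto.mono_left nhdsWithin_le_nhds
  have h3 : (fun w => m w * q.eval w) =ᶠ[𝓝[≠] z] fun w => n.eval w := by
    filter_upwards [eventually_eval_ne_zero hq z,
      mem_nhdsWithin_of_mem_nhds (hopen.mem_nhds hz)] with w hw hwi
    rw [h w hwi, div_mul_cancel₀ _ hw]
  have h4 := tendsto_nhds_unique (h1.congr' h3) h2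
  rw [h0, mul_zero] at h4
  obtain ⟨a, b, hab⟩ := hnq
  have := congrArg (Polynomial.eval z) hab
  simp [h0, ← h4] at this

/-- The poles of a rational Herglotz–Nevanlinna function are simple with negative residues. -/
theorem IsHerglotzNevanlinna.residue_neg (hm : IsHerglotzNevanlinna m)
    (hnq : IsCoprime n q) (hq : q ≠ 0) (h : ∀ z : ℂ, z.im ≠ 0 → m z = n.eval z / q.eval z)
    {x : ℂ} (hx : x.im = 0) (h0 : q.eval x = 0) :
    q.rootMultiplicity x = 1 ∧ (n.eval x / q.derivative.eval x).im = 0 ∧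
      (n.eval x / q.derivative.eval x).re < 0 := by
  obtain ⟨q₁, hq₁, hdvd⟩ := exists_eq_pow_rootMultiplicity_mul_and_not_dvd q hq x
  have hk : q.rootMultiplicity x ≠ 0 := ((rootMultiplicity_pos hq).2 h0).ne'
  set k := q.rootMultiplicity x
  have hq₁x : q₁.eval x ≠ 0 := fun h1 => hdvd (dvd_iff_isRoot.2 h1)
  have hnx : n.eval x ≠ 0 := by
    intro h1
    obtain ⟨a, b, hab⟩ := hnq
    have := congrArg (Polynomial.eval x) hab
    simp [h0, h1] at this
  have hc : n.eval x / q₁.eval x ≠ 0 := div_ne_zero hnx hq₁x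
  have hlim : ∀ w : ℂ, 0 < w.im → 0 ≤ (n.eval x / q₁.eval x * (w⁻¹) ^ k).im := by
    intro w hw
    -- this is `t ^ k * Im m(x + t w)` for `t > 0`
    have hcont : ContinuousAt (fun t : ℝ =>
        (n.eval (x + t * w) / q₁.eval (x + t * w) * (w⁻¹) ^ k).im) 0 := by
      refine Complex.continuous_im.continuousAt.comp (ContinuousAt.mul (ContinuousAt.div ?_ ?_ ?_)
        continuousAt_const)
      · fun_prop
      · fun_prop
      · simpa using hq₁x
    have ht := hcont.tendsto.mono_left (nhdsWithin_le_nhds (s := Set.Ioi (0 : ℝ)))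
    simp only [Complex.ofReal_zero, zero_mul, add_zero] at ht
    refine ge_of_tendsto ht ?_
    filter_upwards [self_mem_nhdsWithin] with t ht
    have ht : 0 < t := ht
    have him : (x + t * w).im = t * w.im := by simp [hx]
    have hpos : 0 < (x + t * w).im := by
      rw [him]
      positivity
    have h1 := hm.im_nonneg _ hpos
    have h2 : n.eval (x + t * w) / q₁.eval (x + t * w) * (w⁻¹) ^ k =
        ((t ^ k : ℝ) : ℂ) * m (x + t * w) := by
      have htc : (t : ℂ) ≠ 0 := by exact_mod_cast ht.ne'
      rw [h _ hpos.ne', hq₁, eval_mul, eval_pow, eval_sub, eval_X, eval_C, add_sub_cancel_left,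
        mul_pow, inv_pow]
      push_cast
      rw [div_mul_eq_mul_div, mul_div_assoc', mul_assoc, mul_div_mul_left _ _ (pow_ne_zero k htc),
        ← div_eq_mul_inv, div_div]
    rw [h2, Complex.im_ofReal_mul]
    positivity
  -- `w ↦ -w⁻¹` maps the upper half-plane onto itself
  obtain ⟨h1, h2, h3⟩ := eq_one_of_im_mul_pow_nonneg hk
    (mul_ne_zero (pow_ne_zero k (neg_ne_zero.2 one_ne_zero)) hc :
      (-1) ^ k * (n.eval x / q₁.eval x) ≠ 0) fun w hw => by
    have := hlim (-w⁻¹) (by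
      have hw0 : w ≠ 0 := by
        rintro rfl
        simp at hw
      have := Complex.normSq_pos.2 hw0
      rw [Complex.neg_im, Complex.inv_im, neg_div, neg_neg]
      positivity)
    rw [inv_neg, inv_inv, neg_pow] at this
    convert this using 2
    ring
  have hder : q.derivative.eval x = q₁.eval x := by
    rw [hq₁, h1]
    simp
  rw [h1] at h2 h3
  rw [hder]
  refine ⟨h1, ?_, ?_⟩
  · simpa using h2
  · simpa using h3

/-- A function with a partial fraction decomposition that maps the upper half-plane into its closure
has a polynomial part of degree at most one, with non-negative leading coefficient. -/
theorem polynomial_part_of_im_nonneg {P : ℂ[X]} {T : Finset ℂ} {r : ℂ → ℂ}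
    (h : ∀ z : ℂ, 0 < z.im → 0 ≤ (P.eval z + ∑ x ∈ T, r x / (z - x)).im) :
    P.natDegree ≤ 1 ∧ (P.coeff 1).im = 0 ∧ 0 ≤ (P.coeff 1).re := by
  rcases Nat.eq_zero_or_pos P.natDegree with h0 | h0
  · have : P.coeff 1 = 0 := coeff_eq_zero_of_natDegree_lt (by omega)
    simp [this, h0]
  set k := P.natDegree with hk
  have hc : P.coeff k ≠ 0 := by
    rw [hk, coeff_natDegree, leadingCoeff_ne_zero]
    rintro rfl
    simp [hk] at h0
  have hlim : ∀ w : ℂ, 0 < w.im → 0 ≤ (P.coeff k * w ^ k).im := by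
    intro w hw
    have hw0 : w ≠ 0 := by
      rintro rfl
      simp at hw
    -- this is the imaginary part of `t ^ k * m(w / t)`, written so as to be continuous at `t = 0`
    have hcont : ContinuousAt (fun t : ℝ =>
        (∑ i ∈ Finset.range (k + 1), P.coeff i * w ^ i * (t : ℂ) ^ (k - i) +
          (t : ℂ) ^ k * ∑ x ∈ T, r x * t / (w - t * x)).im) 0 := by
      refine Complex.continuous_im.continuousAt.comp (ContinuousAt.add ?_ (ContinuousAt.mul ?_ ?_))
      · fun_prop
      · fun_prop
      · refine tendsto_finsetSum _ fun x _ => ContinuousAt.div ?_ ?_ ?_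
        · fun_prop
        · fun_prop
        · simpa using hw0
    have ht := hcont.tendsto.mono_left (nhdsWithin_le_nhds (s := Set.Ioi (0 : ℝ)))
    have hval : ∑ i ∈ Finset.range (k + 1), P.coeff i * w ^ i * ((0 : ℝ) : ℂ) ^ (k - i) +
          ((0 : ℝ) : ℂ) ^ k * ∑ x ∈ T, r x * ((0 : ℝ) : ℂ) / (w - ((0 : ℝ) : ℂ) * x) =
        P.coeff k * w ^ k := by
      rw [Finset.sum_range_succ, Finset.sum_eq_zero]
      · simp [h0.ne']
      · intro i hi
        have : k - i ≠ 0 := by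
          have := Finset.mem_range.1 hi
          omega
        simp [this]
    rw [hval] at ht
    refine ge_of_tendsto ht ?_
    filter_upwards [self_mem_nhdsWithin] with t ht
    have ht : 0 < t := ht
    have htc : (t : ℂ) ≠ 0 := by exact_mod_cast ht.ne'
    have him : (w / t).im = w.im / t := Complex.div_ofReal_im w t
    have h1 := h (w / t) (by rw [him]; positivity)
    have h2 : ∑ i ∈ Finset.range (k + 1), P.coeff i * w ^ i * (t : ℂ) ^ (k - i) +
          (t : ℂ) ^ k * ∑ x ∈ T, r x * t / (w - t * x) =
        ((t ^ k : ℝ) : ℂ) * (P.eval (w / t) + ∑ x ∈ T, r x / (w / t - x)) := by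
      rw [eval_eq_sum_range, mul_add]
      push_cast
      congr 1
      · rw [Finset.mul_sum]
        refine Finset.sum_congr rfl fun i hi => ?_
        have hik : i ≤ k := Nat.lt_succ_iff.1 (Finset.mem_range.1 hi)
        have : (t : ℂ) ^ k = t ^ (k - i) * t ^ i := by rw [← pow_add, Nat.sub_add_cancel hik]
        rw [this, div_pow]
        field_simp
      · congr 1
        refine Finset.sum_congr rfl fun x _ => ?_
        rw [show w / (t : ℂ) - x = (w - t * x) / t by field_simp, div_div_eq_mul_div]
    rw [h2, Complex.im_ofReal_mul]
    positivity
  obtain ⟨h1, h2, h3⟩ := eq_one_of_im_mul_pow_nonneg h0.ne' hc hlim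
  rw [h1] at h2 h3
  exact ⟨h1.le, h2, h3.le⟩

/-- Partial fractions of a rational Herglotz–Nevanlinna function. -/
theorem IsHerglotzNevanlinna.exists_partial_fractions (hm : IsHerglotzNevanlinna m)
    (R : RatFunc ℂ) (hR : ∀ z : ℂ, z.im ≠ 0 → m z = R.eval (RingHom.id ℂ) z) :
    ∃ (A b : ℝ) (S : Finset ℝ) (c : ℝ → ℝ), 0 ≤ b ∧ (∀ x ∈ S, 0 < c x) ∧
      S.card ≤ numPoles R ∧
      ∀ z : ℂ, z.im ≠ 0 → m z = A + b * z + ∑ x ∈ S, (c x : ℂ) / (x - z) := by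
  classical
  set n := R.num with hn
  set q := R.denom with hq
  have hmonic : q.Monic := R.monic_denom
  have hq0 : q ≠ 0 := hmonic.ne_zero
  have hnq : IsCoprime n q := R.isCoprime_num_denom
  have h : ∀ z : ℂ, z.im ≠ 0 → m z = n.eval z / q.eval z := fun z hz => by
    rw [hR z hz, RatFunc.eval, ← eval₂_id, ← eval₂_id]
  set T := q.roots.toFinset with hT
  have hmem : ∀ x, x ∈ T ↔ q.eval x = 0 := fun x => by
    rw [hT, Multiset.mem_toFinset, mem_roots hq0, IsRoot.def]
  have him : ∀ x ∈ T, x.im = 0 := fun x hx => by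
    by_contra h0
    exact hm.denom_eval_ne_zero hnq hq0 h h0 ((hmem x).1 hx)
  have hres := fun x (hx : x ∈ T) => hm.residue_neg hnq hq0 h (him x hx) ((hmem x).1 hx)
  have hnod : q.roots.Nodup := Multiset.nodup_iff_count_le_one.2 fun x => by
    by_cases hx : x ∈ T
    · rw [count_roots, (hres x hx).1]
    · rw [Multiset.count_eq_zero_of_notMem fun h => hx (Multiset.mem_toFinset.2 h)]
      exact zero_le_one
  have hqT : q = Lagrange.nodal T id := by
    rw [(IsAlgClosed.splits q).eq_prod_roots_of_monic hmonic, Lagrange.nodal, Finset.prod,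
      hT, Multiset.toFinset_val, hnod.dedup]
    rfl
  set P := n /ₘ q with hP
  set r : ℂ → ℂ := fun x => n.eval x / q.derivative.eval x with hr
  have hpf : ∀ z : ℂ, z.im ≠ 0 → m z = P.eval z + ∑ x ∈ T, r x / (z - x) := by
    intro z hz
    have hqz := hm.denom_eval_ne_zero hnq hq0 h hz
    have hdeg : (n %ₘ q).degree < T.card := by
      refine (degree_modByMonic_lt n hmonic).trans_eq ?_
      rw [hqT, Lagrange.degree_nodal]
    have hrem := Lagrange.eq_interpolate (v := (id : ℂ → ℂ)) Function.injective_id.injOn hdeg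
    have hev := Lagrange.eval_interpolate_not_at_node (s := T) (v := (id : ℂ → ℂ))
      (fun i => (n %ₘ q).eval (id i)) (x := z) fun x hx hzx => hz (hzx ▸ him x hx)
    rw [← hrem, ← hqT] at hev
    rw [h z hz]
    conv_lhs => rw [← modByMonic_add_div n q, eval_add, hev, eval_mul]
    rw [add_div, mul_div_cancel_left₀ _ hqz, mul_div_cancel_left₀ _ hqz, add_comm]
    congr 1
    refine Finset.sum_congr rfl fun x hx => ?_
    have hnx : (n %ₘ q).eval x = n.eval x := by
      conv_rhs => rw [← modByMonic_add_div n q, eval_add, eval_mul, (hmem x).1 hx, zero_mul,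
        add_zero]
    rw [Lagrange.nodalWeight_eq_eval_derivative_nodal hx, ← hqT]
    simp only [id, hnx, hr]
    rw [div_eq_mul_inv, div_eq_mul_inv]
    ring
  obtain ⟨hdeg, hb1, hb2⟩ := polynomial_part_of_im_nonneg (P := P) (T := T) (r := r) fun z hz => by
    rw [← hpf z hz.ne']
    exact hm.im_nonneg z hz
  have hPz : ∀ z, P.eval z = P.coeff 0 + P.coeff 1 * z := fun z => by
    conv_lhs => rw [eq_X_add_C_of_natDegree_le_one hdeg]
    simp
    ring
  have hb : P.coeff 1 = ((P.coeff 1).re : ℂ) := Complex.ext (by simp) (by simpa using hb1)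
  have hrx : ∀ x ∈ T, r x = ((r x).re : ℂ) := fun x hx =>
    Complex.ext (by simp) (by simpa using (hres x hx).2.1)
  have hxx : ∀ x ∈ T, x = (x.re : ℂ) := fun x hx =>
    Complex.ext (by simp) (by simpa using him x hx)
  -- the constant term is real by symmetry
  have hA : P.coeff 0 = ((P.coeff 0).re : ℂ) := by
    have hI : (Complex.I).im ≠ 0 := by simp
    have h1 := hm.symm Complex.I hI
    rw [hpf _ hI, hpf _ (by simp), hPz, hPz, map_add, map_add, map_mul, map_sum] at h1
    have h2 : ∑ x ∈ T, conj (r x / (Complex.I - x)) = ∑ x ∈ T, r x / (conj Complex.I - x) := by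
      refine Finset.sum_congr rfl fun x hx => ?_
      rw [hrx x hx, hxx x hx]
      simp
    have h3 : conj (P.coeff 1) = P.coeff 1 := by
      rw [hb]
      simp
    rw [h2, h3] at h1
    exact (Complex.conj_eq_iff_re.1 (add_right_cancel (add_right_cancel h1))).symm
  refine ⟨(P.coeff 0).re, (P.coeff 1).re, T.image Complex.re, fun x => -(r x).re, hb2, ?_, ?_, ?_⟩
  · intro x hx
    obtain ⟨y, hy, rfl⟩ := Finset.mem_image.1 hx
    change 0 < -(r (y.re : ℂ)).re
    rw [← hxx y hy]
    exact neg_pos.2 (hres y hy).2.2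
  · exact Finset.card_image_le
  · intro z hz
    rw [hpf z hz, hPz, ← hA, ← hb, Finset.sum_image]
    · congr 1
      refine Finset.sum_congr rfl fun x hx => ?_
      push_cast
      rw [← hxx x hx, ← hrx x hx, ← neg_sub x z, div_neg, neg_div]
    · intro x hx y hy hxy
      rw [hxx x hx, hxx y hy, hxy]

end Rational

/-! ### Integral representations of rational functions -/

section Representation

open Filter Topology

variable {m : ℂ → ℂ} {a b : ℝ} {ρ : Measure ℝ}

theorem ofReal_sub_ne_zero {z : ℂ} (hz : z.im ≠ 0) (x : ℝ) : (x : ℂ) - z ≠ 0 := fun h0 =>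
  hz (by rw [← sub_eq_zero.1 h0, Complex.ofReal_im])

/-- A finite sum of point masses gives an integral representation. -/
theorem exists_isHerglotzRepresentation {A b : ℝ} {S : Finset ℝ} {c : ℝ → ℝ} (hb : 0 ≤ b)
    (hc : ∀ x ∈ S, 0 < c x)
    (h : ∀ z : ℂ, z.im ≠ 0 → m z = A + b * z + ∑ x ∈ S, (c x : ℂ) / (x - z)) :
    ∃ (a b : ℝ) (ρ : Measure ℝ), IsHerglotzRepresentation m a b ρ := by
  have hint : ∀ {E : Type} [NormedAddCommGroup E] (f : ℝ → E), ∀ x ∈ S,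
      Integrable f (ENNReal.ofReal (c x) • Measure.dirac x) := fun f x _ =>
    (integrable_dirac (by simp)).smul_measure ENNReal.ofReal_ne_top
  refine ⟨A + ∑ x ∈ S, c x * (x / (1 + x ^ 2)), b,
    ∑ x ∈ S, ENNReal.ofReal (c x) • Measure.dirac x, hb,
    integrable_finsetSum_measure.2 (hint _), fun z hz => ?_⟩
  rw [h z hz, integral_finsetSum_measure (hint _)]
  push_cast
  have : ∀ x ∈ S, ∫ t : ℝ, (1 / ((t : ℂ) - z) - (t : ℂ) / (1 + (t : ℂ) ^ 2))
      ∂(ENNReal.ofReal (c x) • Measure.dirac x) =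
      (c x : ℂ) / (x - z) - (c x : ℂ) * (x / (1 + (x : ℂ) ^ 2)) := fun x hx => by
    rw [integral_smul_measure, integral_dirac, ENNReal.toReal_ofReal (hc x hx).le,
      Complex.real_smul]
    ring
  rw [Finset.sum_congr rfl this, Finset.sum_sub_distrib]
  ring

namespace IsHerglotzRepresentation

theorem integrable_kernel (h : IsHerglotzRepresentation m a b ρ) {z : ℂ} (hz : z.im ≠ 0) :
    Integrable (fun x : ℝ => 1 / ((x : ℂ) - z) - (x : ℂ) / (1 + (x : ℂ) ^ 2)) ρ := by
  have h1 : Integrable (fun x : ℝ => ((1 / (1 + x ^ 2) : ℝ) : ℂ)) ρ := h.growth.ofReal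
  have h2 : Continuous fun x : ℝ => z + (1 + z ^ 2) / ((x : ℂ) - z) := by
    refine continuous_const.add (continuous_const.div (by fun_prop) fun x => ?_)
    exact ofReal_sub_ne_zero hz x
  have h3 := h1.bdd_mul (c := ‖z‖ + ‖1 + z ^ 2‖ / |z.im|) h2.aestronglyMeasurable
    (Eventually.of_forall fun x => ?_)
  · refine h3.congr (Eventually.of_forall fun x => ?_)
    have hx := ofReal_sub_ne_zero hz x
    have hx2 : (1 : ℂ) + (x : ℂ) ^ 2 ≠ 0 := by
      have : (1 + x ^ 2 : ℝ) ≠ 0 := by positivity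
      exact_mod_cast this
    simp only
    push_cast
    field_simp
    ring
  · refine (norm_add_le _ _).trans (add_le_add_right ?_ _)
    rw [norm_div]
    have : |z.im| ≤ ‖(x : ℂ) - z‖ := by
      simpa using Complex.abs_im_le_norm ((x : ℂ) - z)
    have := abs_pos.2 hz
    gcongr

/-- The imaginary part of a Herglotz–Nevanlinna function is a Poisson integral. -/
theorem im_eq (h : IsHerglotzRepresentation m a b ρ) (x : ℝ) {y : ℝ} (hy : 0 < y) :
    Integrable (fun t : ℝ => y / ((t - x) ^ 2 + y ^ 2)) ρ ∧
      (m ⟨x, y⟩).im = b * y + ∫ t : ℝ, y / ((t - x) ^ 2 + y ^ 2) ∂ρ := by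
  have hz : (⟨x, y⟩ : ℂ).im ≠ 0 := hy.ne'
  have hk := h.integrable_kernel hz
  have him : ∀ t : ℝ, (1 / ((t : ℂ) - (⟨x, y⟩ : ℂ)) - (t : ℂ) / (1 + (t : ℂ) ^ 2)).im =
      y / ((t - x) ^ 2 + y ^ 2) := fun t => by
    have h1 : ((t : ℂ) / (1 + (t : ℂ) ^ 2)).im = 0 := by
      have : (t : ℂ) / (1 + (t : ℂ) ^ 2) = ((t / (1 + t ^ 2) : ℝ) : ℂ) := by push_cast; rfl
      rw [this, Complex.ofReal_im]
    rw [Complex.sub_im, h1, one_div, Complex.inv_im, Complex.normSq_apply]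
    simp
    ring
  have h2 : Integrable (fun t : ℝ => y / ((t - x) ^ 2 + y ^ 2)) ρ := by
    have := hk.im
    refine this.congr (Eventually.of_forall fun t => him t)
  refine ⟨h2, ?_⟩
  rw [h.eq _ hz, Complex.add_im]
  have h3 := integral_im hk
  have h4 : (∫ t : ℝ, (1 / ((t : ℂ) - (⟨x, y⟩ : ℂ)) - (t : ℂ) / (1 + (t : ℂ) ^ 2)) ∂ρ).im =
      ∫ t : ℝ, y / ((t - x) ^ 2 + y ^ 2) ∂ρ := by
    refine h3.symm.trans (integral_congr_ae (Eventually.of_forall fun t => him t))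
  rw [h4]
  simp

/-- The Poisson kernel is at least `1 / (2 y)` on an interval of radius `y`. -/
theorem measure_Icc_le (h : IsHerglotzRepresentation m a b ρ) (x : ℝ) {y : ℝ} (hy : 0 < y) :
    ρ (Set.Icc (x - y) (x + y)) ≤ ENNReal.ofReal (2 * y * (m ⟨x, y⟩).im) := by
  obtain ⟨h1, h2⟩ := h.im_eq x hy
  have hsub : Set.Icc (x - y) (x + y) ⊆ {t | 1 / (2 * y) ≤ y / ((t - x) ^ 2 + y ^ 2)} := by
    rintro t ⟨ht1, ht2⟩
    have h3 : (t - x) ^ 2 ≤ y ^ 2 := sq_le_sq' (by linarith) (by linarith)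
    rw [Set.mem_ofPred_eq, div_le_div_iff₀ (by positivity) (by positivity)]
    nlinarith
  have hlt : ρ {t | 1 / (2 * y) ≤ y / ((t - x) ^ 2 + y ^ 2)} < ⊤ :=
    h1.measure_ge_lt_top (by positivity)
  have hm := mul_meas_ge_le_integral_of_nonneg (Eventually.of_forall fun t => by
    simp only [Pi.zero_apply]
    positivity) h1 (1 / (2 * y))
  refine (measure_mono hsub).trans ?_
  rw [← ofReal_measureReal hlt.ne]
  refine ENNReal.ofReal_le_ofReal ?_
  rw [div_mul_eq_mul_div, one_mul, div_le_iff₀' (by positivity)] at hm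
  refine hm.trans (mul_le_mul_of_nonneg_left ?_ (by positivity))
  rw [h2]
  have := mul_nonneg h.b_nonneg hy.le
  linarith

end IsHerglotzRepresentation

/-- A measure whose values on intervals are bounded by the square of the length vanishes on
intervals. -/
theorem measure_Icc_eq_zero_of_le_sq {p q K : ℝ} (hpq : p < q)
    (h : ∀ u v, p ≤ u → u < v → v ≤ q → ρ (Set.Icc u v) ≤ ENNReal.ofReal (K * (v - u) ^ 2)) :
    ρ (Set.Icc p q) = 0 := by
  have key : ∀ n : ℕ, ∀ u v, p ≤ u → u < v → v ≤ q →
      ρ (Set.Icc u v) ≤ ENNReal.ofReal (K * (v - u) ^ 2 * (1 / 2) ^ n) := by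
    intro n
    induction n with
    | zero => simpa using h
    | succ n ih =>
      intro u v hu huv hv
      have h1 := ih u ((u + v) / 2) hu (by linarith) (by linarith)
      have h2 := ih ((u + v) / 2) v (by linarith) (by linarith) hv
      refine (measure_mono (Set.Icc_subset_Icc_union_Icc (b := (u + v) / 2))).trans
        ((measure_union_le _ _).trans ((add_le_add h1 h2).trans ?_))
      rw [show (u + v) / 2 - u = (v - u) / 2 by ring, show v - (u + v) / 2 = (v - u) / 2 by ring,
        ← two_mul, ← ENNReal.ofReal_ofNat, ← ENNReal.ofReal_mul (by norm_num)]
      refine (congrArg ENNReal.ofReal ?_).le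
      ring
  have hlim : Tendsto (fun n : ℕ => ENNReal.ofReal (K * (q - p) ^ 2 * (1 / 2) ^ n)) atTop
      (𝓝 0) := by
    rw [← ENNReal.ofReal_zero]
    refine ENNReal.tendsto_ofReal ?_
    simpa using (tendsto_pow_atTop_nhds_zero_of_lt_one (r := (1 / 2 : ℝ)) (by norm_num)
      (by norm_num)).const_mul (K * (q - p) ^ 2)
  exact le_antisymm (ge_of_tendsto' hlim fun n => key n p q le_rfl hpq le_rfl) bot_le

/-- The measure of a rational Herglotz–Nevanlinna function does not charge the complement of the
poles: away from the poles the imaginary part is `O(y)`, so that an interval of length `2 y` has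
measure `O(y ^ 2)`. -/
theorem IsHerglotzRepresentation.measure_compl (h : IsHerglotzRepresentation m a b ρ)
    {A b₀ : ℝ} {S : Finset ℝ} {c : ℝ → ℝ} (hc : ∀ x ∈ S, 0 < c x)
    (hm : ∀ z : ℂ, z.im ≠ 0 → m z = A + b₀ * z + ∑ x ∈ S, (c x : ℂ) / (x - z)) :
    ρ ((S : Set ℝ)ᶜ) = 0 := by
  refine measure_null_of_locally_null _ fun x₀ hx₀ => ?_
  obtain ⟨ε, hε, hball⟩ := Metric.mem_nhds_iff.1 (S.finite_toSet.isClosed.isOpen_compl.mem_nhds hx₀)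
  have hdist : ∀ x ∈ S, ε ≤ |x - x₀| := fun x hx => by
    by_contra! hlt
    exact hball (Metric.mem_ball.2 (by rwa [Real.dist_eq])) hx
  refine ⟨Set.Icc (x₀ - ε / 2) (x₀ + ε / 2), mem_nhdsWithin_of_mem_nhds
    (Icc_mem_nhds (by linarith) (by linarith)), ?_⟩
  refine measure_Icc_eq_zero_of_le_sq (K := (b₀ + ∑ x ∈ S, c x / (ε / 2) ^ 2) / 2) (by linarith)
    fun u v hu huv hv => ?_
  have hy : 0 < (v - u) / 2 := by linarith
  have h1 := h.measure_Icc_le ((u + v) / 2) hy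
  rw [show (u + v) / 2 - (v - u) / 2 = u by ring, show (u + v) / 2 + (v - u) / 2 = v by ring] at h1
  refine h1.trans (ENNReal.ofReal_le_ofReal ?_)
  set x := (u + v) / 2 with hx
  set y := (v - u) / 2 with hyd
  have him : (m ⟨x, y⟩).im ≤ (b₀ + ∑ x ∈ S, c x / (ε / 2) ^ 2) * y := by
    rw [hm _ hy.ne', Complex.add_im, Complex.im_sum, add_mul, Finset.sum_mul]
    refine add_le_add (le_of_eq (by simp)) (Finset.sum_le_sum fun t ht => ?_)
    have h2 : ((c t : ℂ) / ((t : ℂ) - (⟨x, y⟩ : ℂ))).im = c t * y / ((t - x) ^ 2 + y ^ 2) := by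
      rw [Complex.div_im, Complex.normSq_apply]
      simp
      ring
    rw [h2, div_mul_eq_mul_div]
    have h3 : (ε / 2) ^ 2 ≤ (t - x) ^ 2 + y ^ 2 := by
      have h4 : ε / 2 ≤ |t - x| := by
        have h5 := hdist t ht
        have h6 : |x - x₀| ≤ ε / 2 := abs_le.2 ⟨by linarith, by linarith⟩
        have h7 := abs_sub_le t x x₀
        linarith
      have h8 := pow_le_pow_left₀ (by positivity) h4 2
      rw [sq_abs] at h8
      nlinarith [sq_nonneg y]
    have h9 := hc t ht
    gcongr
  calc 2 * y * (m ⟨x, y⟩).im ≤ 2 * y * ((b₀ + ∑ x ∈ S, c x / (ε / 2) ^ 2) * y) := by gcongr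
    _ = (b₀ + ∑ x ∈ S, c x / (ε / 2) ^ 2) / 2 * (v - u) ^ 2 := by
      rw [hyd]
      ring

end Representation

section FiniteSupport

open Filter

variable {m : ℂ → ℂ} {a b : ℝ} {ρ : Measure ℝ} {S : Finset ℝ}

theorem IsHerglotzRepresentation.measure_singleton_lt_top (h : IsHerglotzRepresentation m a b ρ)
    (x : ℝ) : ρ {x} < ⊤ := by
  refine (measure_mono ?_).trans_lt
    (h.growth.measure_ge_lt_top (show (0 : ℝ) < 1 / (1 + x ^ 2) by positivity))
  rintro t rfl
  exact le_rfl (a := 1 / (1 + t ^ 2))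

/-- The measure is finite as it is carried by finitely many points, each of finite mass. -/
theorem IsHerglotzRepresentation.isFiniteMeasure (h : IsHerglotzRepresentation m a b ρ)
    (hS : ρ ((S : Set ℝ)ᶜ) = 0) : IsFiniteMeasure ρ := by
  refine ⟨?_⟩
  rw [← Set.union_compl_self (S : Set ℝ)]
  refine (measure_union_le _ _).trans_lt ?_
  rw [hS, add_zero]
  rw [← Set.biUnion_of_singleton (S : Set ℝ)]
  refine (measure_biUnion_finset_le S fun x => {x}).trans_lt ?_
  exact ENNReal.sum_lt_top.2 fun x _ => h.measure_singleton_lt_top x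

theorem restrict_finset_eq_self (hS : ρ ((S : Set ℝ)ᶜ) = 0) : ρ.restrict (S : Set ℝ) = ρ :=
  Measure.restrict_eq_self_of_ae_mem (mem_ae_iff.2 hS)

theorem integrable_of_measure_compl_finset [IsFiniteMeasure ρ] (hS : ρ ((S : Set ℝ)ᶜ) = 0)
    {E : Type*} [NormedAddCommGroup E] (f : ℝ → E) : Integrable f ρ := by
  have : IntegrableOn f (S : Set ℝ) ρ := IntegrableOn.finset
  rwa [IntegrableOn, restrict_finset_eq_self hS] at this

/-- Integration with respect to a measure with finite support, as a sum over the point masses. -/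
theorem integral_of_measure_compl_finset [IsFiniteMeasure ρ] (hS : ρ ((S : Set ℝ)ᶜ) = 0)
    {E : Type*} [NormedAddCommGroup E] [NormedSpace ℝ E] [CompleteSpace E] (f : ℝ → E) :
    ∫ x, f x ∂ρ = ∑ x ∈ S with 0 < ρ.real {x}, ρ.real {x} • f x := by
  have h1 := setIntegral_finset (μ := ρ) S (f := f) IntegrableOn.finset
  rw [restrict_finset_eq_self hS] at h1
  rw [h1, Finset.sum_filter_of_ne]
  intro x _ hne
  refine measureReal_nonneg.lt_of_ne' fun h0 => hne ?_
  rw [h0, zero_smul]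

end FiniteSupport

/-- A rational Herglotz–Nevanlinna function has an integral representation, and for the (unique)
data `a`, `b`, `ρ` of this representation all moments exist and the continued fraction expansion
holds with the coefficients given by the Hankel determinants of the extended moments. -/
theorem proposition1p2 (m : ℂ → ℂ) (hm : IsHerglotzNevanlinna m) (R : RatFunc ℂ)
    (hR : ∀ z : ℂ, z.im ≠ 0 → m z = R.eval (RingHom.id ℂ) z) :
    (∃ (a b : ℝ) (ρ : Measure ℝ), IsHerglotzRepresentation m a b ρ) ∧
    ∀ (a b : ℝ) (ρ : Measure ℝ), IsHerglotzRepresentation m a b ρ →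
      (∀ k : ℕ, Integrable (fun x : ℝ => x ^ k) ρ) ∧
      ∀ (s : ℤ → ℝ) (Δ : ℤ → ℕ → ℝ) (κ : ℕ → ℕ) (N : ℕ),
      s = extMoment a b ρ → Δ = hankelDet s → κ = kappa s → N = cfLength s (numPoles R) →
      (∀ n : ℕ, 1 ≤ n → n ≤ N + 1 → Δ 0 (κ n) ≠ 0 ∧ Δ 1 (κ n) ≠ 0) ∧
      (∀ n : ℕ, 1 ≤ n → n ≤ N → Δ 0 (κ n + 1) ≠ 0) ∧
      ∃ (υ ω l : ℕ → ℝ) (r : ℝ),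
        υ 0 = -(Δ (-2) 1 / Δ 0 0) ∧
        (∀ n : ℕ, 1 ≤ n → n ≤ N →
          υ n = Δ (-2) (κ n + 2) / Δ 0 (κ n + 1)
            - Δ (-2) (κ (n + 1) + 1) / Δ 0 (κ (n + 1))) ∧
        ω 0 = -(Δ (-1) 1 / Δ 1 0) ∧
        (∀ n : ℕ, 1 ≤ n → n ≤ N →
          ω n = Δ (-1) (κ n + 1) / Δ 1 (κ n)
            - Δ (-1) (κ (n + 1) + 1) / Δ 1 (κ (n + 1))) ∧
        (∀ n : ℕ, 1 ≤ n → n ≤ N →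
          l n = Δ 1 (κ n) ^ 2 / (Δ 0 (κ n) * Δ 0 (κ n + 1))) ∧
        r = Δ 0 (κ (N + 1)) * Δ 0 (κ (N + 1) + 1) / Δ 1 (κ (N + 1)) ^ 2 ∧
        (∀ n : ℕ, n ≤ N → 0 ≤ υ n) ∧
        (∀ n : ℕ, 1 ≤ n → n ≤ N → 0 < l n) ∧
        0 ≤ r ∧
        ∀ z : ℂ, z.im ≠ 0 → CFWellDefined υ ω l r N z ∧ m z = cfValue υ ω l r N z := by
  obtain ⟨A, b₀, S, c, hb₀, hc, hcard, hpf⟩ := hm.exists_partial_fractions R hR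
  refine ⟨exists_isHerglotzRepresentation hb₀ hc hpf, fun a b ρ h => ?_⟩
  have hS := h.measure_compl hc hpf
  have := h.isFiniteMeasure hS
  refine ⟨fun k => integrable_of_measure_compl_finset hS _, fun s Δ κ N hs hΔ hκ hN => ?_⟩
  set S' := S.filter fun x => 0 < ρ.real {x} with hS'
  have hsneg : s (-2) = -b := by
    rw [hs]
    rfl
  have hsone : s (-1) = (∫ x : ℝ, x / (1 + x ^ 2) ∂ρ) - a := by
    rw [hs]
    rfl
  have hfin : IsFiniteMomentSequence s S' fun x => ρ.real {x} := by
    refine ⟨fun x hx => (Finset.mem_filter.1 hx).2, fun k => ?_⟩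
    rw [hs]
    exact integral_of_measure_compl_finset hS _
  obtain ⟨h1, h2, υ, ω, l, r, e1, e2, e3, e4, e5, e6, e7, e8, e9, hcf⟩ :=
    hfin.continuedFraction ((Finset.card_filter_le _ _).trans hcard)
      (by rw [hsneg]; exact neg_nonpos.2 h.b_nonneg) Δ κ N hΔ hκ hN
  refine ⟨h1, h2, υ, ω, l, r, e1, e2, e3, e4, e5, e6, e7, e8, e9, fun z hz => ⟨(hcf z hz).1, ?_⟩⟩
  rw [← (hcf z hz).2, h.eq z hz, integral_of_measure_compl_finset hS, hsneg, hsone,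
    integral_of_measure_compl_finset hS, cauchyTransform_apply, ← hS']
  simp only [Complex.real_smul, smul_eq_mul, mul_sub, Finset.sum_sub_distrib, Polynomial.eval_one]
  push_cast
  simp only [mul_one_div, mul_one]
  ring
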